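/- Let $A\in\mathbb R^{n\times n}$, $H\in\mathbb R^{m\times n}$ with $(A,H)$ observable, and let $Q\in\mathbb R^{n\times n}$, $R\in\mathbb R^{m\times m}$ be symmetric positive definite. For $L\in\mathbb R^{n\times m}$ put $A_L=A-LH$. Let $\mathcal S=\{L:\rho(A_L)<1\}$, where $\rho$ is the spectral radius, and for $L\in\mathcal S$ let $$X_{(L)}=\sum_{t=0}^{\infty}A_L^{t}\,(Q+LRL^{\top})\,(A_L^{\top})^{t},\qquad J(L)=\operatorname{tr}\big(X_{(L)}H^{\top}H\big)+\operatorname{tr}(R).$$ Let $\nabla J$ be the gradient of $J$ for the Frobenius inner product $\langle M,N\rangle=\operatorname{tr}(M^{\top}N)$, with norm $\|\cdot\|_F$. Let $\alpha>0$ be such that the sublevel set $\mathcal S_\alpha=\{L\in\mathcal S: J(L)\le\alpha\}$ is non-empty. Then $J$ is differentiable on $\mathcal S$ and has a unique minimizer $L^*$ over $\mathcal S$. There are constants $c_1,c_2,c_3>0$ (depending on $\alpha$ and on the data $A,H,Q,R$, but not on $L$) such that for all $L\in\mathcal S_\alpha$ $$c_1\,[J(L)-J(L^*)]+c_2\,\|L-L^*\|_F^2\le\langle\nabla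 J(L),\nabla J(L)\rangle,\qquad c_3\,\|L-L^*\|_F^2\le J(L)-J(L^*).\tag{$*$}$$ For every $L_0\in\mathcal S_\alpha$ the gradient flow $\dot L_s=-\nabla J(L_s)$ with initial value $L_0$ has a solution on $[0,\infty)$. Moreover, for any positive constants $c_1,c_2,c_3$ satisfying $(*)$ on $\mathcal S_\alpha$ and any such solution, for all $s\ge 0$: $L_s\in\mathcal S_\alpha$, $$J(L_s)-J(L^*)\le(\alpha-J(L^*))\,e^{-c_1 s}\quad\text{and}\quad\|L_s-L^*\|_F^2\le\frac{\alpha-J(L^*)}{c_3}\,e^{-c_1 s}.$$ -/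

import Mathlib

open Matrix

namespace KalmanGain

noncomputable section

/-- The pair `(A, H)` is observable: an initial state `v` of `x(t+1) = A x(t)` whose outputs
`H A ^ t v` all vanish is zero. -/
def IsObservable {n m : ℕ} (A : Matrix (Fin n) (Fin n) ℝ) (H : Matrix (Fin m) (Fin n) ℝ) : Prop :=
  ∀ v : Fin n → ℝ, (∀ t : ℕ, (H * A ^ t) *ᵥ v = 0) → v = 0

/-- The closed-loop matrix `A_L = A - L H`. -/
def closedLoop {n m : ℕ} (A : Matrix (Fin n) (Fin n) ℝ) (H : Matrix (Fin m) (Fin n) ℝ)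
    (L : Matrix (Fin n) (Fin m) ℝ) : Matrix (Fin n) (Fin n) ℝ :=
  A - L * H

/-- The set `𝒮` of Schur stabilizing gains: all complex eigenvalues of `A - L H` lie in the open
unit disc. -/
def stabilizing {n m : ℕ} (A : Matrix (Fin n) (Fin n) ℝ) (H : Matrix (Fin m) (Fin n) ℝ) :
    Set (Matrix (Fin n) (Fin m) ℝ) :=
  {L | spectralRadius ℂ ((closedLoop A H L).map Complex.ofReal) < 1}

/-- The steady-state error covariance `X(L) = ∑ₜ A_L ^ t (Q + L R Lᵀ) (A_Lᵀ) ^ t`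
(the series converges for stabilizing `L`). -/
def steadyCov {n m : ℕ} (A : Matrix (Fin n) (Fin n) ℝ) (H : Matrix (Fin m) (Fin n) ℝ)
    (Q : Matrix (Fin n) (Fin n) ℝ) (R : Matrix (Fin m) (Fin m) ℝ)
    (L : Matrix (Fin n) (Fin m) ℝ) : Matrix (Fin n) (Fin n) ℝ :=
  ∑' t : ℕ, closedLoop A H L ^ t * (Q + L * R * Lᵀ) * (closedLoop A H L)ᵀ ^ t

/-- The steady-state mean-squared prediction error `J(L) = tr(X(L) Hᵀ H) + tr(R)`, meaningful on
the stabilizing gains. -/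
def cost {n m : ℕ} (A : Matrix (Fin n) (Fin n) ℝ) (H : Matrix (Fin m) (Fin n) ℝ)
    (Q : Matrix (Fin n) (Fin n) ℝ) (R : Matrix (Fin m) (Fin m) ℝ)
    (L : Matrix (Fin n) (Fin m) ℝ) : ℝ :=
  (steadyCov A H Q R L * (Hᵀ * H)).trace + R.trace

/-- The sublevel set `𝒮_α` of `J`. -/
def sublevel {n m : ℕ} (A : Matrix (Fin n) (Fin n) ℝ) (H : Matrix (Fin m) (Fin n) ℝ)
    (Q : Matrix (Fin n) (Fin n) ℝ) (R : Matrix (Fin m) (Fin m) ℝ) (α : ℝ) :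
    Set (Matrix (Fin n) (Fin m) ℝ) :=
  {L | L ∈ stabilizing A H ∧ cost A H Q R L ≤ α}

/-- The Frobenius inner product `⟨M, N⟩ = tr(Mᵀ N)`; thus `‖M‖_F² = frobInner M M`. -/
def frobInner {n m : ℕ} (M N : Matrix (Fin n) (Fin m) ℝ) : ℝ :=
  (Mᵀ * N).trace

/-- The gradient of `f` at `L` for the Frobenius inner product. -/
def frobGradient {n m : ℕ} (f : Matrix (Fin n) (Fin m) ℝ → ℝ) (L : Matrix (Fin n) (Fin m) ℝ) :
    Matrix (Fin n) (Fin m) ℝ :=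
  Matrix.of fun i j => fderiv ℝ f L (Matrix.single i j 1)

/-- `frobGradient f L` represents the Fréchet derivative of `f` at `L`. -/
theorem frobInner_frobGradient {n m : ℕ} (f : Matrix (Fin n) (Fin m) ℝ → ℝ)
    (L D : Matrix (Fin n) (Fin m) ℝ) :
    frobInner (frobGradient f L) D = fderiv ℝ f L D := by
  have h : D = ∑ i, ∑ j, D i j • Matrix.single i j (1 : ℝ) := by
    conv_lhs => rw [Matrix.matrix_eq_sum_single D]
    simp [Matrix.smul_single]
  conv_rhs => rw [h]
  simp only [map_sum, map_smul, smul_eq_mul]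
  rw [Finset.sum_comm]
  simp [frobInner, frobGradient, Matrix.trace, Matrix.mul_apply, mul_comm]

/-- `c₁, c₂, c₃` are gradient dominance constants of `J` on `𝒮_α`, with `Lstar` the minimizer:
they are positive and for all `L ∈ 𝒮_α`
`c₁ (J(L) - J(L*)) + c₂ ‖L - L*‖_F² ≤ ⟨∇J(L), ∇J(L)⟩` and `c₃ ‖L - L*‖_F² ≤ J(L) - J(L*)`. -/
def IsGradientDominance {n m : ℕ} (A : Matrix (Fin n) (Fin n) ℝ) (H : Matrix (Fin m) (Fin n) ℝ)
    (Q : Matrix (Fin n) (Fin n) ℝ) (R : Matrix (Fin m) (Fin m) ℝ) (α : ℝ)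
    (Lstar : Matrix (Fin n) (Fin m) ℝ) (c₁ c₂ c₃ : ℝ) : Prop :=
  0 < c₁ ∧ 0 < c₂ ∧ 0 < c₃ ∧ ∀ L ∈ sublevel A H Q R α,
    c₁ * (cost A H Q R L - cost A H Q R Lstar) + c₂ * frobInner (L - Lstar) (L - Lstar)
        ≤ frobInner (frobGradient (cost A H Q R) L) (frobGradient (cost A H Q R) L) ∧
    c₃ * frobInner (L - Lstar) (L - Lstar) ≤ cost A H Q R L - cost A H Q R Lstar

/-- `γ` is a solution on `[0, ∞)` of the gradient flow `γ' = -∇f(γ)`, `γ(0) = L₀`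
(one-sided derivative at `0`). -/
def IsGradientFlow {n m : ℕ} (f : Matrix (Fin n) (Fin m) ℝ → ℝ) (L₀ : Matrix (Fin n) (Fin m) ℝ)
    (γ : ℝ → Matrix (Fin n) (Fin m) ℝ) : Prop :=
  γ 0 = L₀ ∧ ∀ s : ℝ, 0 ≤ s → HasDerivWithinAt γ (-frobGradient f (γ s)) (Set.Ici 0) s

end

end KalmanGain

/-! The cost `J` is studied through the solution `X(L)` of the Lyapunov equation of `A_L = A - L H`
and the dual solution `Y(L)`, the observability Gramian of `(A_L, H)`. Everything rests on one exact
identity (`cost_sub_cost`): with `E(L) = L R - A_L X(L) Hᵀ` and `Δ = L' - L`,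
`J(L') - J(L) = 2 tr(Y(L') E(L) Δᵀ) + tr(Y(L') Δ (R + H X(L) Hᵀ) Δᵀ)`.

Letting `Δ` tend to zero shows that the gradient of `J` is `2 Y(L) E(L)` (`fderiv_cost_apply`). As
`Y` is positive definite by observability, `E` vanishes at a minimizer `L*`, and there the identity
leaves a positive quadratic term: `L*` is the only minimizer and the gap `J(L) - J(L*)` grows
quadratically (`quadratic_growth`). Exchanging the roles of `L` and `L*` and completing the square
bounds the gap by `‖E(L)‖²`, hence by the squared norm of the gradient (`cost_gap_le_residual`,
`two_mul_norm_residual_le`). The constants are uniform because `Y(L)` is uniformly positive definite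
on a sublevel set (`exists_obsGramian_lower_bound`).

The sublevel sets are compact (`isCompact_sublevel`). They are bounded: the cost dominates the
squared norms of the matrices `H A_Lᵗ L`, these control `H Aᵗ L` because `A = A_L + L H`, and
finitely many of the latter determine `L` by observability (`exists_norm_le_of_mem_sublevel`). They
are closed: the trace of `X(L)` is bounded on them, which gives a common bound for `∑ₜ ‖A_Lᵗ‖²`, and
such a bound survives passing to limits and forces stability (`isClosed_sublevel`).

For the flow, the gradient field is cut off outside a compact neighbourhood of the sublevel set, so
that it becomes bounded and Lipschitz and has global solutions (`exists_damped_forward_solution`).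
A descent curve cannot leave the sublevel set (`mem_sublevel_of_descent`), so the cutoff is never
felt, and the same fact confines every solution of the gradient flow. The rates then follow by
monotonicity of `(J(γ s) - J(L*)) exp (c₁ s)`. -/

namespace KalmanGain
noncomputable section

open scoped Matrix.Norms.Frobenius Topology NNReal ENNReal Manifold
open Filter

/-! ### Frobenius norm and positive semidefinite matrices -/

theorem frobInner_eq_sum {n m : ℕ} (M N : Matrix (Fin n) (Fin m) ℝ) :
    frobInner M N = ∑ p : Fin n × Fin m, M p.1 p.2 * N p.1 p.2 := by
  simp only [frobInner, Matrix.trace, Matrix.diag, Matrix.mul_apply, Matrix.transpose_apply]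
  rw [Finset.sum_comm, Fintype.sum_prod_type]

theorem frobInner_self {n m : ℕ} (M : Matrix (Fin n) (Fin m) ℝ) :
    frobInner M M = ‖M‖ ^ 2 := by
  rw [frobInner_eq_sum, Matrix.frobenius_norm_def, ← Real.sqrt_eq_rpow,
    Real.sq_sqrt (by positivity), Fintype.sum_prod_type]
  simp [← sq]

theorem abs_frobInner_le {n m : ℕ} (M N : Matrix (Fin n) (Fin m) ℝ) :
    |frobInner M N| ≤ ‖M‖ * ‖N‖ := by
  apply abs_le_of_sq_le_sq _ (by positivity)
  rw [mul_pow, ← frobInner_self, ← frobInner_self]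
  simp only [frobInner_eq_sum, ← sq]
  exact Finset.sum_mul_sq_le_sq_mul_sq _ _ _

theorem PosSemidef.trace_mul_nonneg {n : ℕ} {P G : Matrix (Fin n) (Fin n) ℝ}
    (hP : P.PosSemidef) (hG : G.PosSemidef) : 0 ≤ (P * G).trace := by
  obtain ⟨B, rfl⟩ : ∃ B : Matrix (Fin n) (Fin n) ℝ, P = Bᴴ * B := by
    open scoped MatrixOrder in
    exact CStarAlgebra.nonneg_iff_eq_star_mul_self.mp hP.nonneg
  rw [Matrix.mul_assoc, Matrix.trace_mul_comm]
  exact (hG.mul_mul_conjTranspose_same B).trace_nonneg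

/-- If `P ≥ c I` in the Loewner order, then `tr (P G) ≥ c tr G` for every positive
semidefinite `G`. -/
theorem mul_trace_le_trace_mul {n : ℕ} {P G : Matrix (Fin n) (Fin n) ℝ} {c : ℝ}
    (hP : (P - c • (1 : Matrix (Fin n) (Fin n) ℝ)).PosSemidef) (hG : G.PosSemidef) :
    c * G.trace ≤ (P * G).trace := by
  have := PosSemidef.trace_mul_nonneg hP hG
  simpa [Matrix.sub_mul, Matrix.trace_sub] using this

theorem posSemidef_mul_mul_transpose {n m : ℕ} {G : Matrix (Fin n) (Fin n) ℝ}
    (hG : G.PosSemidef) (B : Matrix (Fin m) (Fin n) ℝ) : (B * G * Bᵀ).PosSemidef := by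
  simpa using hG.mul_mul_conjTranspose_same B

theorem posSemidef_transpose_mul_self {n m : ℕ} (B : Matrix (Fin n) (Fin m) ℝ) :
    (Bᵀ * B).PosSemidef := by
  simpa using Matrix.posSemidef_conjTranspose_mul_self B

theorem posSemidef_mul_transpose_self {n m : ℕ} (B : Matrix (Fin n) (Fin m) ℝ) :
    (B * Bᵀ).PosSemidef := by
  simpa using Matrix.posSemidef_self_mul_conjTranspose B

theorem trace_mul_transpose_self {n m : ℕ} (B : Matrix (Fin n) (Fin m) ℝ) :
    (B * Bᵀ).trace = ‖B‖ ^ 2 := by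
  rw [← frobInner_self, frobInner, Matrix.trace_mul_comm]

/-- If `P ≥ c I` with `c ≥ 0` and `S ≥ r I`, `S ≥ 0`, then `tr (P Δ S Δᵀ) ≥ c r ‖Δ‖²`. -/
theorem mul_norm_sq_le_trace {n m : ℕ} {P : Matrix (Fin n) (Fin n) ℝ}
    {S : Matrix (Fin m) (Fin m) ℝ} {c r : ℝ} (hc : 0 ≤ c)
    (hP : (P - c • (1 : Matrix (Fin n) (Fin n) ℝ)).PosSemidef)
    (hS : (S - r • (1 : Matrix (Fin m) (Fin m) ℝ)).PosSemidef) (hS' : S.PosSemidef)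
    (D : Matrix (Fin n) (Fin m) ℝ) :
    c * r * ‖D‖ ^ 2 ≤ (P * (D * S * Dᵀ)).trace := by
  have h1 := mul_trace_le_trace_mul hP (posSemidef_mul_mul_transpose hS' D)
  have h2 := mul_trace_le_trace_mul hS (posSemidef_transpose_mul_self D)
  have h3 : (D * S * Dᵀ).trace = (S * (Dᵀ * D)).trace := by
    rw [Matrix.mul_assoc, Matrix.trace_mul_comm, Matrix.mul_assoc]
  have h4 : (Dᵀ * D).trace = ‖D‖ ^ 2 := frobInner_self D
  rw [h4] at h2
  rw [h3] at h1
  nlinarith [mul_le_mul_of_nonneg_left h2 hc]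

/-- A continuous family of positive definite matrices over a compact set is bounded below by a
common positive multiple of the identity. -/
theorem exists_uniform_lower_bound {X : Type*} [TopologicalSpace X] {n : ℕ} {K : Set X}
    (hK : IsCompact K) {f : X → Matrix (Fin n) (Fin n) ℝ} (hf : ContinuousOn f K)
    (hpos : ∀ x ∈ K, (f x).PosDef) :
    ∃ c > (0 : ℝ), ∀ x ∈ K, (f x - c • (1 : Matrix (Fin n) (Fin n) ℝ)).PosSemidef := by
  have hcomp : IsCompact (K ×ˢ Metric.sphere (0 : Fin n → ℝ) 1) := hK.prod (isCompact_sphere _ _)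
  have hcont : ContinuousOn (fun p : X × (Fin n → ℝ) => p.2 ⬝ᵥ (f p.1) *ᵥ p.2)
      (K ×ˢ Metric.sphere (0 : Fin n → ℝ) 1) := by
    have h1 : ContinuousOn (fun p : X × (Fin n → ℝ) => f p.1)
        (K ×ˢ Metric.sphere (0 : Fin n → ℝ) 1) :=
      hf.comp continuousOn_fst (fun p hp => hp.1)
    have h2 : Continuous fun q : Matrix (Fin n) (Fin n) ℝ × (Fin n → ℝ) => q.2 ⬝ᵥ q.1 *ᵥ q.2 := by
      fun_prop
    exact h2.comp_continuousOn (h1.prodMk continuousOn_snd)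
  obtain ⟨c, hc, hle⟩ := hcomp.exists_forall_le' hcont (a := 0) (by
    rintro ⟨x, v⟩ ⟨hx, hv⟩
    have hv0 : v ≠ 0 := by
      rintro rfl
      simp at hv
    simpa using (hpos x hx).dotProduct_mulVec_pos hv0)
  -- The sphere is that of the sup norm, and `v ⬝ᵥ v ≤ n ‖v‖²`; `n + 1` avoids dividing by `n = 0`.
  refine ⟨c / ((n : ℝ) + 1), by positivity, fun x hx => ?_⟩
  refine Matrix.PosSemidef.of_dotProduct_mulVec_nonneg ?_ fun v => ?_
  · exact (hpos x hx).isHermitian.sub (by simp [Matrix.IsHermitian])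
  · rcases eq_or_ne v 0 with rfl | hv
    · simp
    have hn : 0 < ‖v‖ := norm_pos_iff.mpr hv
    have h1 := hle (x, ‖v‖⁻¹ • v) ⟨hx, by simp [norm_smul, hn.ne']⟩
    simp only [Matrix.mulVec_smul, smul_dotProduct, dotProduct_smul, smul_eq_mul] at h1
    have h2 : c * ‖v‖ ^ 2 ≤ v ⬝ᵥ f x *ᵥ v := by
      have := mul_le_mul_of_nonneg_right h1 (sq_nonneg ‖v‖)
      calc c * ‖v‖ ^ 2 ≤ _ := this
        _ = _ := by field_simp
    have h3 : v ⬝ᵥ v ≤ n * ‖v‖ ^ 2 := by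
      have : ∀ i ∈ Finset.univ, v i * v i ≤ ‖v‖ ^ 2 := fun i _ => by
        rw [← sq, ← sq_abs]
        exact pow_le_pow_left₀ (abs_nonneg _) (norm_le_pi_norm v i) 2
      simpa [dotProduct] using Finset.sum_le_card_nsmul _ _ _ this
    have h4 : c / ((n : ℝ) + 1) * (v ⬝ᵥ v) ≤ c * ‖v‖ ^ 2 := by
      rw [div_mul_eq_mul_div, div_le_iff₀ (by positivity)]
      nlinarith [mul_le_mul_of_nonneg_left h3 hc.le, mul_nonneg hc.le (sq_nonneg ‖v‖)]
    simp only [star_trivial, Matrix.sub_mulVec, Matrix.smul_mulVec, Matrix.one_mulVec,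
      dotProduct_sub, dotProduct_smul, smul_eq_mul]
    linarith

theorem PosDef.exists_lower_bound {n : ℕ} {P : Matrix (Fin n) (Fin n) ℝ} (hP : P.PosDef) :
    ∃ c > (0 : ℝ), (P - c • (1 : Matrix (Fin n) (Fin n) ℝ)).PosSemidef := by
  obtain ⟨c, hc, h⟩ := exists_uniform_lower_bound (isCompact_singleton (x := ())) (f := fun _ => P)
    continuousOn_const (fun _ _ => hP)
  exact ⟨c, hc, h () rfl⟩

/-! ### Schur stability -/

theorem nnnorm_map_ofReal_pow {n : ℕ} (M : Matrix (Fin n) (Fin n) ℝ) (t : ℕ) :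
    ‖(M.map Complex.ofReal) ^ t‖₊ = ‖M ^ t‖₊ := by
  have : (M.map Complex.ofReal) ^ t = (M ^ t).map Complex.ofReal :=
    (map_pow (Complex.ofRealHom.mapMatrix) M t).symm
  rw [this]
  exact Matrix.frobenius_nnnorm_map_eq _ _ (fun a => by simp)

/-- Root test: by Gelfand's formula the powers of a Schur stable matrix decay geometrically. -/
theorem summable_norm_pow_of_spectralRadius_lt_one {n : ℕ} {M : Matrix (Fin n) (Fin n) ℝ}
    (h : spectralRadius ℂ (M.map Complex.ofReal) < 1) : Summable fun t : ℕ => ‖M ^ t‖ := by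
  obtain ⟨r, hr, hr1⟩ := ENNReal.lt_iff_exists_nnreal_btwn.mp h
  have hr1 : r < 1 := by exact_mod_cast hr1
  have hev := (spectrum.pow_nnnorm_pow_one_div_tendsto_nhds_spectralRadius
    (M.map Complex.ofReal)).eventually (eventually_lt_nhds hr)
  have hle : ∀ᶠ t : ℕ in atTop, ‖‖M ^ t‖‖ ≤ (r : ℝ) ^ t := by
    filter_upwards [hev, eventually_gt_atTop 0] with t ht ht0
    have ht0' : (t : ℝ) ≠ 0 := by positivity
    rw [nnnorm_map_ofReal_pow] at ht
    have h2 := ENNReal.rpow_le_rpow ht.le (Nat.cast_nonneg t : (0 : ℝ) ≤ t)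
    rw [← ENNReal.rpow_mul, one_div_mul_cancel ht0', ENNReal.rpow_one,
      ENNReal.rpow_natCast] at h2
    rw [norm_norm]
    exact_mod_cast h2
  exact Summable.of_norm_bounded_eventually_nat
    (summable_geometric_of_lt_one r.coe_nonneg (by exact_mod_cast hr1)) hle

/-- A matrix is Schur stable as soon as one of its powers has small enough Frobenius norm (the
factor `‖1‖` accounts for the Frobenius norm of the identity). -/
theorem spectralRadius_lt_one_of_norm_pow_lt {n : ℕ} {M : Matrix (Fin n) (Fin n) ℝ} {k : ℕ}
    (h : ‖M ^ (k + 1)‖ * ‖(1 : Matrix (Fin n) (Fin n) ℝ)‖ < 1) :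
    spectralRadius ℂ (M.map Complex.ofReal) < 1 := by
  refine (spectrum.spectralRadius_le_pow_nnnorm_pow_one_div ℂ _ k).trans_lt ?_
  have h1 := nnnorm_map_ofReal_pow M 0
  rw [pow_zero, pow_zero] at h1
  rw [nnnorm_map_ofReal_pow, h1, ← ENNReal.mul_rpow_of_nonneg _ _ (by positivity)]
  refine ENNReal.rpow_lt_one ?_ (by positivity)
  exact_mod_cast h

theorem exists_norm_pow_lt {n : ℕ} {M : Matrix (Fin n) (Fin n) ℝ}
    (h : Tendsto (fun t : ℕ => ‖M ^ t‖) atTop (𝓝 0)) :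
    ∃ k : ℕ, ‖M ^ (k + 1)‖ * ‖(1 : Matrix (Fin n) (Fin n) ℝ)‖ < 1 := by
  have := ((tendsto_add_atTop_iff_nat 1).mpr h).mul_const ‖(1 : Matrix (Fin n) (Fin n) ℝ)‖
  rw [zero_mul] at this
  exact (this.eventually (eventually_lt_nhds one_pos)).exists

theorem isOpen_stabilizing {n m : ℕ} (A : Matrix (Fin n) (Fin n) ℝ)
    (H : Matrix (Fin m) (Fin n) ℝ) : IsOpen (stabilizing A H) := by
  rw [isOpen_iff_mem_nhds]
  intro L hL
  obtain ⟨k, hk⟩ :=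
    exists_norm_pow_lt (summable_norm_pow_of_spectralRadius_lt_one hL).tendsto_atTop_zero
  have hcont : Continuous fun L : Matrix (Fin n) (Fin m) ℝ =>
      ‖closedLoop A H L ^ (k + 1)‖ * ‖(1 : Matrix (Fin n) (Fin n) ℝ)‖ := by
    unfold closedLoop
    fun_prop
  filter_upwards [hcont.continuousAt.eventually (eventually_lt_nhds hk)] with L' hL'
  exact spectralRadius_lt_one_of_norm_pow_lt hL'

/-! ### The Stein equation in a Banach algebra -/

section Stein
variable {E : Type*} [NormedRing E] [NormedAlgebra ℝ E]

/-- The operator `z ↦ a z b` on a normed algebra. -/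
abbrev steinOp (a b : E) : E →L[ℝ] E := ContinuousLinearMap.mulLeftRight ℝ E a b

theorem steinOp_pow_apply (a b z : E) (t : ℕ) : (steinOp a b ^ t) z = a ^ t * z * b ^ t := by
  induction t generalizing z with
  | zero => simp
  | succ t ih =>
    rw [pow_succ, mul_apply_eq_comp, ih, ContinuousLinearMap.mulLeftRight_apply,
      pow_succ a, pow_succ' b]
    simp only [mul_assoc]

variable [CompleteSpace E]

theorem summable_steinOp_pow {a b : E} (h : Summable fun t : ℕ => ‖a ^ t‖ * ‖b ^ t‖) :
    Summable fun t : ℕ => steinOp a b ^ t := by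
  refine Summable.of_norm_bounded h fun t => ?_
  refine ContinuousLinearMap.opNorm_le_bound _ (by positivity) fun z => ?_
  rw [steinOp_pow_apply]
  refine (norm_mul_le _ _).trans ?_
  rw [mul_right_comm]
  exact mul_le_mul_of_nonneg_right (norm_mul_le _ _) (norm_nonneg _)

/-- The Neumann series of `z ↦ a z b` applied to `g` solves the Stein equation `z = a z b + g`. -/
theorem hasSum_stein {a b : E} (h : Summable fun t : ℕ => ‖a ^ t‖ * ‖b ^ t‖) (g : E) :
    HasSum (fun t : ℕ => a ^ t * g * b ^ t) ((∑' t : ℕ, steinOp a b ^ t) g) := by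
  have h1 := (ContinuousLinearMap.apply ℝ E g).hasSum (summable_steinOp_pow h).hasSum
  simpa only [Function.comp_def, ContinuousLinearMap.apply_apply, steinOp_pow_apply] using h1

/-- The resolvent of `z ↦ a z b` at `1` is the sum of its Neumann series. -/
theorem isUnit_one_sub_steinOp {a b : E} (h : Summable fun t : ℕ => ‖a ^ t‖ * ‖b ^ t‖) :
    ∃ u : (E →L[ℝ] E)ˣ, (u : E →L[ℝ] E) = 1 - steinOp a b ∧
      (↑u⁻¹ : E →L[ℝ] E) = ∑' t : ℕ, steinOp a b ^ t :=
  have hs := summable_steinOp_pow h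
  ⟨⟨1 - steinOp a b, ∑' t, steinOp a b ^ t, hs.one_sub_mul_tsum_pow, hs.tsum_pow_mul_one_sub⟩,
    rfl, rfl⟩

theorem eq_tsum_stein_iff {a b : E} (h : Summable fun t : ℕ => ‖a ^ t‖ * ‖b ^ t‖) {g z : E} :
    z = ∑' t : ℕ, a ^ t * g * b ^ t ↔ z = a * z * b + g := by
  obtain ⟨u, hu, hinv⟩ := isUnit_one_sub_steinOp h
  have key : z = a * z * b + g ↔ (u : E →L[ℝ] E) z = g := by
    rw [hu]
    simp [sub_eq_iff_eq_add, add_comm]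
  rw [key, (hasSum_stein h g).tsum_eq, ← hinv]
  constructor
  · rintro rfl
    rw [← mul_apply_eq_comp, Units.mul_inv]
    rfl
  · rintro rfl
    rw [← mul_apply_eq_comp, Units.inv_mul]
    rfl

/-- The solution of the Stein equation depends smoothly on the data, being the value of an
operator inverse. -/
theorem contDiffAt_tsum_stein {F : Type*} [NormedAddCommGroup F] [NormedSpace ℝ F] {k : ℕ∞}
    {a b g : F → E} {x : F} (ha : ContDiffAt ℝ k a x) (hb : ContDiffAt ℝ k b x)
    (hg : ContDiffAt ℝ k g x)
    (hx : ∀ᶠ y in 𝓝 x, Summable fun t : ℕ => ‖a y ^ t‖ * ‖b y ^ t‖) :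
    ContDiffAt ℝ k (fun y => ∑' t : ℕ, a y ^ t * g y * b y ^ t) x := by
  have hbil : ContDiff ℝ k fun p : E × E => steinOp p.1 p.2 := by
    unfold steinOp
    fun_prop
  have hop : ContDiffAt ℝ k (fun y => 1 - steinOp (a y) (b y)) x :=
    contDiffAt_const.sub <| ContDiffAt.comp (f := fun y => (a y, b y))
      (g := fun p : E × E => steinOp p.1 p.2) x hbil.contDiffAt (ha.prodMk hb)
  obtain ⟨u, hu, -⟩ := isUnit_one_sub_steinOp hx.self_of_nhds
  have hinv : ContDiffAt ℝ k (fun y => Ring.inverse (1 - steinOp (a y) (b y))) x := by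
    have h1 := contDiffAt_ringInverse ℝ (n := k) u
    rw [hu] at h1
    exact h1.comp x hop
  refine (hinv.clm_apply hg).congr_of_eventuallyEq ?_
  filter_upwards [hx] with y hy
  obtain ⟨w, hw, hw'⟩ := isUnit_one_sub_steinOp hy
  rw [(hasSum_stein hy _).tsum_eq, ← hw', ← hw, Ring.inverse_unit]

end Stein

/-! ### The discrete Lyapunov equation -/

/-- The solution `∑ₜ Mᵗ G (Mᵀ)ᵗ` of the discrete Lyapunov equation `X = M X Mᵀ + G`. -/
def lyap {n : ℕ} (M G : Matrix (Fin n) (Fin n) ℝ) : Matrix (Fin n) (Fin n) ℝ :=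
  ∑' t : ℕ, M ^ t * G * Mᵀ ^ t

section Lyapunov
variable {n : ℕ} {M : Matrix (Fin n) (Fin n) ℝ}

theorem summable_norm_pow_mul_norm_transpose_pow (hM : Summable fun t : ℕ => ‖M ^ t‖) :
    Summable fun t : ℕ => ‖M ^ t‖ * ‖Mᵀ ^ t‖ := by
  simp only [← Matrix.transpose_pow, Matrix.frobenius_norm_transpose]
  refine Summable.of_norm_bounded_eventually_nat hM ?_
  filter_upwards [hM.tendsto_atTop_zero.eventually (eventually_lt_nhds one_pos)] with t ht
  rw [norm_mul, norm_norm]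
  exact mul_le_of_le_one_left (norm_nonneg _) ht.le

theorem hasSum_lyap (hM : Summable fun t : ℕ => ‖M ^ t‖) (G : Matrix (Fin n) (Fin n) ℝ) :
    HasSum (fun t : ℕ => M ^ t * G * Mᵀ ^ t) (lyap M G) :=
  (hasSum_stein (summable_norm_pow_mul_norm_transpose_pow hM) G).summable.hasSum

theorem eq_lyap_iff (hM : Summable fun t : ℕ => ‖M ^ t‖) {G Z : Matrix (Fin n) (Fin n) ℝ} :
    Z = lyap M G ↔ Z = M * Z * Mᵀ + G := 
  eq_tsum_stein_iff (summable_norm_pow_mul_norm_transpose_pow hM)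

theorem lyap_eq (hM : Summable fun t : ℕ => ‖M ^ t‖) (G : Matrix (Fin n) (Fin n) ℝ) :
    lyap M G = M * lyap M G * Mᵀ + G :=
  (eq_lyap_iff hM).mp rfl

theorem lyap_posSemidef (hM : Summable fun t : ℕ => ‖M ^ t‖) {G : Matrix (Fin n) (Fin n) ℝ}
    (hG : G.PosSemidef) : (lyap M G).PosSemidef := by
  have hterm : ∀ t : ℕ, (M ^ t * G * Mᵀ ^ t).PosSemidef := fun t => by
    rw [← Matrix.transpose_pow]
    exact posSemidef_mul_mul_transpose hG _
  refine Matrix.PosSemidef.of_dotProduct_mulVec_nonneg ?_ fun v => ?_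
  · have h1 := (hasSum_lyap hM G).map (Matrix.transposeAddEquiv (Fin n) (Fin n) ℝ)
      (by exact continuous_id.matrix_transpose)
    have h2 : (lyap M G)ᵀ = lyap M G := by
      refine h1.unique ((hasSum_lyap hM G).congr_fun fun t => ?_)
      simpa [Matrix.IsHermitian] using (hterm t).isHermitian
    simpa [Matrix.IsHermitian] using h2
  · have h1 := (hasSum_lyap hM G).map
      (AddMonoidHom.mk' (fun Z : Matrix (Fin n) (Fin n) ℝ => v ⬝ᵥ Z *ᵥ v)
        (fun a b => by simp [Matrix.add_mulVec]))
      (by show Continuous fun Z : Matrix (Fin n) (Fin n) ℝ => v ⬝ᵥ Z *ᵥ v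
          fun_prop)
    exact h1.nonneg fun t => by simpa using (hterm t).dotProduct_mulVec_nonneg v

theorem lyap_eq_sum_add (hM : Summable fun t : ℕ => ‖M ^ t‖) (G : Matrix (Fin n) (Fin n) ℝ)
    (T : ℕ) : lyap M G =
      ∑ t ∈ Finset.range T, M ^ t * G * (M ^ t)ᵀ + M ^ T * lyap M G * (M ^ T)ᵀ := by
  induction T with
  | zero => simp
  | succ T ih =>
    rw [Finset.sum_range_succ, add_assoc]
    conv_lhs => rw [ih]
    congr 1
    conv_lhs => rw [lyap_eq hM G]
    simp only [pow_succ, Matrix.transpose_mul, Matrix.mul_add, Matrix.add_mul, Matrix.mul_assoc]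
    abel

theorem summable_norm_transpose_pow (hM : Summable fun t : ℕ => ‖M ^ t‖) :
    Summable fun t : ℕ => ‖Mᵀ ^ t‖ := by
  simpa [← Matrix.transpose_pow, Matrix.frobenius_norm_transpose] using hM

/-- The Lyapunov solution maps for `M` and `Mᵀ` are adjoint for the trace pairing. -/
theorem trace_lyap_mul (hM : Summable fun t : ℕ => ‖M ^ t‖) (G P : Matrix (Fin n) (Fin n) ℝ) :
    (lyap M G * P).trace = (lyap Mᵀ P * G).trace := by
  have h1 := lyap_eq hM G
  have h2 := lyap_eq (summable_norm_transpose_pow hM) P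
  rw [Matrix.transpose_transpose] at h2
  generalize lyap M G = X at h1 ⊢
  generalize lyap Mᵀ P = Y at h2 ⊢
  have hP : P = Y - Mᵀ * Y * M := eq_sub_of_add_eq' h2.symm
  have hG : G = X - M * X * Mᵀ := eq_sub_of_add_eq' h1.symm
  have h3 : (X * (Mᵀ * Y * M)).trace = (Y * (M * X * Mᵀ)).trace := by
    rw [Matrix.trace_mul_comm, Matrix.mul_assoc, Matrix.mul_assoc, Matrix.trace_mul_comm]
    simp only [Matrix.mul_assoc]
  rw [hP, hG, Matrix.mul_sub, Matrix.mul_sub, Matrix.trace_sub, Matrix.trace_sub, h3,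
    Matrix.trace_mul_comm X Y]

end Lyapunov

theorem contDiff_transpose {k : ℕ∞} {a b : ℕ} :
    ContDiff ℝ k fun Z : Matrix (Fin a) (Fin b) ℝ => Zᵀ :=
  (Matrix.transposeLinearEquiv (Fin a) (Fin b) ℝ ℝ).toLinearMap.toContinuousLinearMap.contDiff

theorem contDiffAt_lyap {F : Type*} [NormedAddCommGroup F] [NormedSpace ℝ F] {n : ℕ} {k : ℕ∞}
    {f g : F → Matrix (Fin n) (Fin n) ℝ} {x : F} (hf : ContDiffAt ℝ k f x)
    (hg : ContDiffAt ℝ k g x) (hx : ∀ᶠ y in 𝓝 x, Summable fun t : ℕ => ‖f y ^ t‖) :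
    ContDiffAt ℝ k (fun y => lyap (f y) (g y)) x := by
  exact contDiffAt_tsum_stein hf (contDiff_transpose.contDiffAt.comp x hf) hg
    (hx.mono fun y hy => summable_norm_pow_mul_norm_transpose_pow hy)

/-! ### The cost and its gradient -/

/-- The dual solution `Y(L) = ∑ₜ (A_Lᵀ)ᵗ Hᵀ H A_Lᵗ`, the observability Gramian of `(A_L, H)`. -/
def obsGramian {n m : ℕ} (A : Matrix (Fin n) (Fin n) ℝ) (H : Matrix (Fin m) (Fin n) ℝ)
    (L : Matrix (Fin n) (Fin m) ℝ) : Matrix (Fin n) (Fin n) ℝ :=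
  lyap (closedLoop A H L)ᵀ (Hᵀ * H)

/-- The matrix `R + H X(L) Hᵀ`, the covariance of the steady-state innovation. -/
def innovCov {n m : ℕ} (A : Matrix (Fin n) (Fin n) ℝ) (H : Matrix (Fin m) (Fin n) ℝ)
    (Q : Matrix (Fin n) (Fin n) ℝ) (R : Matrix (Fin m) (Fin m) ℝ)
    (L : Matrix (Fin n) (Fin m) ℝ) : Matrix (Fin m) (Fin m) ℝ :=
  R + H * steadyCov A H Q R L * Hᵀ

/-- The residual `L R - A_L X(L) Hᵀ`, which vanishes exactly at the Kalman gain. The gradient of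
the cost is `2 Y(L)` times this matrix. -/
def residual {n m : ℕ} (A : Matrix (Fin n) (Fin n) ℝ) (H : Matrix (Fin m) (Fin n) ℝ)
    (Q : Matrix (Fin n) (Fin n) ℝ) (R : Matrix (Fin m) (Fin m) ℝ)
    (L : Matrix (Fin n) (Fin m) ℝ) : Matrix (Fin n) (Fin m) ℝ :=
  L * R - closedLoop A H L * steadyCov A H Q R L * Hᵀ

section Cost
variable {n m : ℕ} {A : Matrix (Fin n) (Fin n) ℝ} {H : Matrix (Fin m) (Fin n) ℝ}
  {Q : Matrix (Fin n) (Fin n) ℝ} {R : Matrix (Fin m) (Fin m) ℝ} {L L' : Matrix (Fin n) (Fin m) ℝ}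

theorem steadyCov_eq_lyap (A : Matrix (Fin n) (Fin n) ℝ) (H : Matrix (Fin m) (Fin n) ℝ)
    (Q : Matrix (Fin n) (Fin n) ℝ) (R : Matrix (Fin m) (Fin m) ℝ)
    (L : Matrix (Fin n) (Fin m) ℝ) :
    steadyCov A H Q R L = lyap (closedLoop A H L) (Q + L * R * Lᵀ) := rfl

theorem summable_norm_closedLoop_pow (hL : L ∈ stabilizing A H) :
    Summable fun t : ℕ => ‖closedLoop A H L ^ t‖ :=
  summable_norm_pow_of_spectralRadius_lt_one hL

theorem posSemidef_noise (hQ : Q.PosSemidef) (hR : R.PosSemidef) (L : Matrix (Fin n) (Fin m) ℝ) :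
    (Q + L * R * Lᵀ).PosSemidef :=
  hQ.add (posSemidef_mul_mul_transpose hR L)

theorem steadyCov_posSemidef (hQ : Q.PosSemidef) (hR : R.PosSemidef)
    (hL : L ∈ stabilizing A H) : (steadyCov A H Q R L).PosSemidef :=
  lyap_posSemidef (summable_norm_closedLoop_pow hL) (posSemidef_noise hQ hR L)

theorem obsGramian_posSemidef (hL : L ∈ stabilizing A H) : (obsGramian A H L).PosSemidef :=
  lyap_posSemidef (summable_norm_transpose_pow (summable_norm_closedLoop_pow hL))
    (posSemidef_transpose_mul_self H)

theorem PosSemidef.transpose_eq {k : ℕ} {P : Matrix (Fin k) (Fin k) ℝ} (hP : P.PosSemidef) :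
    Pᵀ = P := by
  simpa [Matrix.IsHermitian] using hP.isHermitian

/-- The residual and the innovation covariance at `L` are the first and second order coefficients
of the defect of `X(L)` in the Lyapunov equation of another gain `L'`. -/
theorem lyapunov_defect (hQ : Q.PosSemidef) (hR : R.PosSemidef) (hL : L ∈ stabilizing A H)
    (L' : Matrix (Fin n) (Fin m) ℝ) :
    closedLoop A H L' * steadyCov A H Q R L * (closedLoop A H L')ᵀ - steadyCov A H Q R L
        + (Q + L' * R * L'ᵀ) =
      (L' - L) * (residual A H Q R L)ᵀ + residual A H Q R L * (L' - L)ᵀ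
        + (L' - L) * innovCov A H Q R L * (L' - L)ᵀ := by
  have hX := lyap_eq (summable_norm_closedLoop_pow hL) (Q + L * R * Lᵀ)
  rw [← steadyCov_eq_lyap] at hX
  have hXt := PosSemidef.transpose_eq (steadyCov_posSemidef hQ hR hL)
  have hRt := PosSemidef.transpose_eq hR
  have hcl : closedLoop A H L' = closedLoop A H L - (L' - L) * H := by
    simp [closedLoop, Matrix.sub_mul]
  unfold residual innovCov
  rw [hcl]
  generalize closedLoop A H L = M at *
  generalize steadyCov A H Q R L = X at *
  obtain ⟨D, rfl⟩ : ∃ D, L' = L + D := ⟨L' - L, by abel⟩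
  rw [add_sub_cancel_left]
  have hQ' : Q = X - M * X * Mᵀ - L * R * Lᵀ := by
    rw [eq_sub_iff_add_eq, eq_sub_iff_add_eq']
    exact hX.symm
  rw [hQ']
  simp only [Matrix.transpose_sub, Matrix.transpose_add, Matrix.transpose_mul, hXt, hRt,
    Matrix.transpose_transpose, Matrix.mul_sub, Matrix.sub_mul, Matrix.mul_add, Matrix.add_mul,
    Matrix.mul_assoc]
  abel

/-- Exact expansion of the cost around `L`, with the Gramian taken at the other gain `L'`. -/
theorem cost_sub_cost (hQ : Q.PosSemidef) (hR : R.PosSemidef) (hL : L ∈ stabilizing A H)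
    (hL' : L' ∈ stabilizing A H) :
    cost A H Q R L' - cost A H Q R L =
      2 * (obsGramian A H L' * (residual A H Q R L * (L' - L)ᵀ)).trace +
        (obsGramian A H L' * ((L' - L) * innovCov A H Q R L * (L' - L)ᵀ)).trace := by
  have hM' := summable_norm_closedLoop_pow hL'
  have hX' := lyap_eq hM' (Q + L' * R * L'ᵀ)
  rw [← steadyCov_eq_lyap] at hX'
  have hD : steadyCov A H Q R L' - steadyCov A H Q R L = lyap (closedLoop A H L')
      (closedLoop A H L' * steadyCov A H Q R L * (closedLoop A H L')ᵀ - steadyCov A H Q R L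
        + (Q + L' * R * L'ᵀ)) := by
    rw [eq_lyap_iff hM']
    conv_lhs => rw [hX']
    simp only [Matrix.mul_sub, Matrix.sub_mul]
    abel
  have hYt := PosSemidef.transpose_eq (obsGramian_posSemidef hL')
  have hsymm : (obsGramian A H L' * ((L' - L) * (residual A H Q R L)ᵀ)).trace =
      (obsGramian A H L' * (residual A H Q R L * (L' - L)ᵀ)).trace := by
    rw [← Matrix.trace_transpose, Matrix.transpose_mul, hYt, Matrix.transpose_mul,
      Matrix.transpose_transpose, Matrix.trace_mul_comm]
  have h1 : cost A H Q R L' - cost A H Q R L =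
      ((steadyCov A H Q R L' - steadyCov A H Q R L) * (Hᵀ * H)).trace := by
    simp only [cost, Matrix.sub_mul, Matrix.trace_sub]
    ring
  rw [h1, hD, trace_lyap_mul hM', lyapunov_defect hQ hR hL]
  change (obsGramian A H L' * _).trace = _
  rw [Matrix.mul_add, Matrix.mul_add, Matrix.trace_add, Matrix.trace_add, hsymm]
  ring

theorem contDiff_mul_right {k : ℕ∞} {a b c : ℕ} (B : Matrix (Fin b) (Fin c) ℝ) :
    ContDiff ℝ k fun Z : Matrix (Fin a) (Fin b) ℝ => Z * B :=
  (LinearMap.toContinuousLinearMap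
    { toFun := fun Z : Matrix (Fin a) (Fin b) ℝ => Z * B
      map_add' := fun x y => Matrix.add_mul x y B
      map_smul' := fun r x => Matrix.smul_mul r x B }).contDiff

theorem contDiff_closedLoop {k : ℕ∞} : ContDiff ℝ k (closedLoop A H) :=
  contDiff_const.sub (contDiff_mul_right H)

theorem contDiff_noise {k : ℕ∞} :
    ContDiff ℝ k fun L : Matrix (Fin n) (Fin m) ℝ => Q + L * R * Lᵀ := by
  have hbil : IsBoundedBilinearMap ℝ
      fun p : Matrix (Fin n) (Fin m) ℝ × Matrix (Fin m) (Fin n) ℝ => p.1 * p.2 :=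
    { add_left := fun _ _ _ => Matrix.add_mul _ _ _
      smul_left := fun _ _ _ => Matrix.smul_mul _ _ _
      add_right := fun _ _ _ => Matrix.mul_add _ _ _
      smul_right := fun _ _ _ => Matrix.mul_smul _ _ _
      bound := ⟨1, one_pos, fun x y => by
        rw [one_mul]
        exact Matrix.frobenius_norm_mul x y⟩ }
  exact contDiff_const.add (hbil.contDiff.comp ((contDiff_mul_right R).prodMk contDiff_transpose))

theorem contDiffAt_cost {k : ℕ∞} (hL : L ∈ stabilizing A H) :
    ContDiffAt ℝ k (cost A H Q R) L := by
  have hX : ContDiffAt ℝ k (steadyCov A H Q R) L :=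
    contDiffAt_lyap contDiff_closedLoop.contDiffAt contDiff_noise.contDiffAt <| by
      filter_upwards [(isOpen_stabilizing A H).mem_nhds hL] with L' hL'
      exact summable_norm_closedLoop_pow hL'
  have htr : ContDiff ℝ k fun Z : Matrix (Fin n) (Fin n) ℝ => (Z * (Hᵀ * H)).trace :=
    (Matrix.traceLinearMap (Fin n) ℝ ℝ).toContinuousLinearMap.contDiff.comp
      (contDiff_mul_right _)
  exact (htr.contDiffAt.comp L hX).add contDiffAt_const

theorem differentiableAt_cost (hL : L ∈ stabilizing A H) :
    DifferentiableAt ℝ (cost A H Q R) L :=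
  (contDiffAt_cost (k := 1) hL).differentiableAt (by norm_num)

theorem continuousAt_obsGramian (hL : L ∈ stabilizing A H) :
    ContinuousAt (obsGramian A H) L := by
  have : ContDiffAt ℝ (0 : ℕ∞) (obsGramian A H) L :=
    contDiffAt_lyap (contDiff_transpose.comp contDiff_closedLoop).contDiffAt contDiffAt_const <| by
      filter_upwards [(isOpen_stabilizing A H).mem_nhds hL] with L' hL'
      exact summable_norm_transpose_pow (summable_norm_closedLoop_pow hL')
  exact this.continuousAt

/-- The derivative of the cost, read off from the exact expansion along a line. -/
theorem fderiv_cost_apply (hQ : Q.PosSemidef) (hR : R.PosSemidef) (hL : L ∈ stabilizing A H)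
    (D : Matrix (Fin n) (Fin m) ℝ) :
    fderiv ℝ (cost A H Q R) L D = 2 * (obsGramian A H L * (residual A H Q R L * Dᵀ)).trace := by
  have hline : ContinuousAt (fun t : ℝ => L + t • D) 0 := by fun_prop
  have hd : HasDerivAt (fun t : ℝ => cost A H Q R (L + t • D)) (fderiv ℝ (cost A H Q R) L D) 0 := by
    have h1 : HasDerivAt (fun t : ℝ => L + t • D) D 0 := by
      have := ((hasDerivAt_id (0 : ℝ)).smul_const D).const_add L
      rwa [one_smul] at this
    have h2 : HasFDerivAt (cost A H Q R) (fderiv ℝ (cost A H Q R) L) (L + (0 : ℝ) • D) := by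
      simpa using (differentiableAt_cost hL).hasFDerivAt
    exact h2.comp_hasDerivAt 0 h1
  rw [hasDerivAt_iff_tendsto_slope_zero] at hd
  have hY : Tendsto (fun t : ℝ => obsGramian A H (L + t • D)) (𝓝[≠] 0) (𝓝 (obsGramian A H L)) := by
    have : ContinuousAt (obsGramian A H) (L + (0 : ℝ) • D) := by
      simpa using continuousAt_obsGramian hL
    have h2 : ContinuousAt (fun t : ℝ => obsGramian A H (L + t • D)) 0 :=
      ContinuousAt.comp (f := fun t : ℝ => L + t • D) this hline
    simpa [ContinuousAt] using h2.tendsto.mono_left nhdsWithin_le_nhds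
  have hid : Tendsto (fun t : ℝ => t) (𝓝[≠] 0) (𝓝 0) := nhdsWithin_le_nhds
  have hc : ∀ B : Matrix (Fin n) (Fin n) ℝ,
      Continuous fun Z : Matrix (Fin n) (Fin n) ℝ => (Z * B).trace := fun B => by fun_prop
  have h1 := (((hc (residual A H Q R L * Dᵀ)).tendsto _).comp hY).const_mul 2
  have h2 := hid.mul (((hc (D * innovCov A H Q R L * Dᵀ)).tendsto _).comp hY)
  have h3 := h1.add h2
  rw [zero_mul, add_zero] at h3
  refine tendsto_nhds_unique hd (h3.congr' ?_)
  have hS : ∀ᶠ t : ℝ in 𝓝[≠] 0, L + t • D ∈ stabilizing A H := by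
    refine (hline.tendsto.mono_left nhdsWithin_le_nhds).eventually ?_
    simpa using (isOpen_stabilizing A H).mem_nhds hL
  filter_upwards [hS, self_mem_nhdsWithin] with t ht ht0
  have ht0 : t ≠ 0 := ht0
  have hexp := cost_sub_cost hQ hR hL ht
  simp only [add_sub_cancel_left, Matrix.transpose_smul, Matrix.mul_smul, Matrix.smul_mul,
    Matrix.trace_smul, smul_eq_mul] at hexp
  simp only [zero_add, zero_smul, add_zero, Function.comp_apply, smul_eq_mul, hexp]
  field_simp

end Cost

/-! ### Observability -/

/-- The observability Gramian over `N` steps of the pair `(M, H)`. -/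
def finGramian {n m : ℕ} (H : Matrix (Fin m) (Fin n) ℝ) (N : ℕ) (M : Matrix (Fin n) (Fin n) ℝ) :
    Matrix (Fin n) (Fin n) ℝ :=
  ∑ t ∈ Finset.range N, (H * M ^ t)ᵀ * (H * M ^ t)

section Sublevel
variable {n m : ℕ} {A : Matrix (Fin n) (Fin n) ℝ} {H : Matrix (Fin m) (Fin n) ℝ}
  {Q : Matrix (Fin n) (Fin n) ℝ} {R : Matrix (Fin m) (Fin m) ℝ} {L : Matrix (Fin n) (Fin m) ℝ}
  {α : ℝ}

/-- Finitely many outputs suffice for observability: the unobservable subspaces over growing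
horizons form a descending chain. -/
theorem IsObservable.exists_horizon (h : IsObservable A H) :
    ∃ N : ℕ, ∀ v : Fin n → ℝ, (∀ t < N, (H * A ^ t) *ᵥ v = 0) → v = 0 := by
  let f : ℕ →o (Submodule ℝ (Fin n → ℝ))ᵒᵈ :=
    { toFun := fun N => OrderDual.toDual
        (⨅ t ∈ Finset.range N, LinearMap.ker (H * A ^ t).mulVecLin)
      monotone' := fun a b hab => OrderDual.toDual_le_toDual.mpr
        (biInf_mono fun t ht => Finset.range_mono hab ht) }
  have hf : ∀ N v, v ∈ OrderDual.ofDual (f N) ↔ ∀ t < N, (H * A ^ t) *ᵥ v = 0 := fun N v => by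
    simp [f, Submodule.mem_iInf]
  obtain ⟨N, hN⟩ := IsArtinian.monotone_stabilizes f
  refine ⟨N, fun v hv => h v fun t => ?_⟩
  have h1 := (hf N v).mpr hv
  rw [hN (max N (t + 1)) (le_max_left _ _)] at h1
  exact (hf _ v).mp h1 t (lt_of_lt_of_le (Nat.lt_succ_self t) (le_max_right _ _))

theorem dotProduct_finGramian_mulVec (N : ℕ) (M : Matrix (Fin n) (Fin n) ℝ) (v : Fin n → ℝ) :
    v ⬝ᵥ finGramian H N M *ᵥ v =
      ∑ t ∈ Finset.range N, ((H * M ^ t) *ᵥ v) ⬝ᵥ ((H * M ^ t) *ᵥ v) := by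
  simp only [finGramian, Matrix.sum_mulVec, dotProduct_sum]
  refine Finset.sum_congr rfl fun t _ => ?_
  rw [← Matrix.mulVec_mulVec, Matrix.dotProduct_mulVec, Matrix.vecMul_transpose]

/-- Output injection preserves observability: along an unobserved trajectory `A - L H` acts as
`A`. -/
theorem finGramian_closedLoop_posDef {N : ℕ}
    (hN : ∀ v : Fin n → ℝ, (∀ t < N, (H * A ^ t) *ᵥ v = 0) → v = 0)
    (L : Matrix (Fin n) (Fin m) ℝ) : (finGramian H N (closedLoop A H L)).PosDef := by
  refine Matrix.PosDef.of_dotProduct_mulVec_pos ?_ fun v hv => ?_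
  · exact (Matrix.posSemidef_sum _ fun t _ => posSemidef_transpose_mul_self _).isHermitian
  · rw [star_trivial, dotProduct_finGramian_mulVec]
    have hnn : ∀ t ∈ Finset.range N, 0 ≤ ((H * closedLoop A H L ^ t) *ᵥ v) ⬝ᵥ
        ((H * closedLoop A H L ^ t) *ᵥ v) := fun t _ =>
      Finset.sum_nonneg fun i _ => mul_self_nonneg _
    refine lt_of_le_of_ne (Finset.sum_nonneg hnn) fun h0 => hv (hN v ?_)
    have hz : ∀ t < N, (H * closedLoop A H L ^ t) *ᵥ v = 0 := fun t ht =>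
      dotProduct_self_eq_zero.mp
        ((Finset.sum_eq_zero_iff_of_nonneg hnn).mp h0.symm t (Finset.mem_range.mpr ht))
    have hpow : ∀ t ≤ N, closedLoop A H L ^ t *ᵥ v = A ^ t *ᵥ v := by
      intro t
      induction t with
      | zero => simp
      | succ t ih =>
        intro ht
        have h1 := hz t (by omega)
        rw [← Matrix.mulVec_mulVec] at h1
        rw [pow_succ', ← Matrix.mulVec_mulVec, pow_succ', ← Matrix.mulVec_mulVec,
          ← ih (by omega), closedLoop, Matrix.sub_mulVec, ← Matrix.mulVec_mulVec _ L H]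
        change _ - L *ᵥ H *ᵥ closedLoop A H L ^ t *ᵥ v = _
        rw [h1, Matrix.mulVec_zero, sub_zero]
    intro t ht
    rw [← hz t ht, ← Matrix.mulVec_mulVec, ← Matrix.mulVec_mulVec, hpow t ht.le]

/-- The finite horizon Gramians of all gains in a ball are uniformly positive definite. -/
theorem exists_finGramian_lower_bound {N : ℕ}
    (hN : ∀ v : Fin n → ℝ, (∀ t < N, (H * A ^ t) *ᵥ v = 0) → v = 0) (B : ℝ) :
    ∃ c > (0 : ℝ), ∀ L : Matrix (Fin n) (Fin m) ℝ, ‖L‖ ≤ B →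
      (finGramian H N (closedLoop A H L) - c • (1 : Matrix (Fin n) (Fin n) ℝ)).PosSemidef := by
  have hcont : Continuous fun L : Matrix (Fin n) (Fin m) ℝ => finGramian H N (closedLoop A H L) := by
    unfold finGramian closedLoop
    fun_prop
  have : ProperSpace (Matrix (Fin n) (Fin m) ℝ) := FiniteDimensional.proper ℝ _
  obtain ⟨c, hc, h⟩ := exists_uniform_lower_bound
    (isCompact_closedBall (0 : Matrix (Fin n) (Fin m) ℝ) B) hcont.continuousOn
    (fun L _ => finGramian_closedLoop_posDef hN L)
  exact ⟨c, hc, fun L hL => h L (by simpa using hL)⟩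

/-! ### The sublevel sets are compact -/

theorem lyap_sub_pow_posSemidef {M G : Matrix (Fin n) (Fin n) ℝ}
    (hM : Summable fun t : ℕ => ‖M ^ t‖) (hG : G.PosSemidef) (t : ℕ) :
    (lyap M G - M ^ t * lyap M G * (M ^ t)ᵀ).PosSemidef := by
  rw [sub_eq_of_eq_add (lyap_eq_sum_add hM G t)]
  exact Matrix.posSemidef_sum _ fun s _ => posSemidef_mul_mul_transpose hG _

theorem lyap_sub_sum_posSemidef {M G : Matrix (Fin n) (Fin n) ℝ}
    (hM : Summable fun t : ℕ => ‖M ^ t‖) (hG : G.PosSemidef) (T : ℕ) :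
    (lyap M G - ∑ t ∈ Finset.range T, M ^ t * G * (M ^ t)ᵀ).PosSemidef := by
  rw [sub_eq_of_eq_add' (lyap_eq_sum_add hM G T)]
  exact posSemidef_mul_mul_transpose (lyap_posSemidef hM hG) _

theorem trace_mul_le_of_sub_posSemidef {X Z P : Matrix (Fin n) (Fin n) ℝ}
    (h : (X - Z).PosSemidef) (hP : P.PosSemidef) : (Z * P).trace ≤ (X * P).trace := by
  have := PosSemidef.trace_mul_nonneg h hP
  rwa [Matrix.sub_mul, Matrix.trace_sub, sub_nonneg] at this

theorem trace_steadyCov_le (hR : R.PosSemidef) (hL : L ∈ sublevel A H Q R α) :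
    (steadyCov A H Q R L * (Hᵀ * H)).trace ≤ α := by
  have h1 := hL.2
  have h2 := hR.trace_nonneg
  unfold cost at h1
  linarith

/-- On a sublevel set the noise `L R Lᵀ` injected by the gain is seen through the outputs: each
`H A_Lᵗ L` is bounded. -/
theorem norm_output_gain_le (hQ : Q.PosSemidef) (hR : R.PosSemidef) {r : ℝ} (hr : 0 < r)
    (hRr : (R - r • (1 : Matrix (Fin m) (Fin m) ℝ)).PosSemidef)
    (hL : L ∈ sublevel A H Q R α) (t : ℕ) :
    ‖H * closedLoop A H L ^ t * L‖ ≤ √(α / r) := by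
  have hM := summable_norm_closedLoop_pow hL.1
  set M := closedLoop A H L with hMdef
  have hG := posSemidef_noise hQ hR L
  have h1 : (steadyCov A H Q R L - M ^ t * L * R * (M ^ t * L)ᵀ).PosSemidef := by
    have h2 : (steadyCov A H Q R L - M ^ t * (Q + L * R * Lᵀ) * (M ^ t)ᵀ).PosSemidef := by
      have h3 := lyap_sub_sum_posSemidef hM hG (t + 1)
      rw [Finset.sum_range_succ, ← steadyCov_eq_lyap] at h3
      have h4 := h3.add (Matrix.posSemidef_sum (Finset.range t)
        fun s _ => posSemidef_mul_mul_transpose hG (M ^ s))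
      convert h4 using 1
      abel
    convert h2.add (posSemidef_mul_mul_transpose hQ (M ^ t)) using 1
    simp only [Matrix.transpose_mul, Matrix.mul_add, Matrix.add_mul, Matrix.mul_assoc]
    abel
  have h5 := (trace_mul_le_of_sub_posSemidef h1 (posSemidef_transpose_mul_self H)).trans
    (trace_steadyCov_le hR hL)
  have h6 := mul_norm_sq_le_trace (P := (1 : Matrix (Fin m) (Fin m) ℝ)) (c := 1) zero_le_one
    (by simpa using Matrix.PosSemidef.zero) hRr hR (H * M ^ t * L)
  have h7 : (M ^ t * L * R * (M ^ t * L)ᵀ * (Hᵀ * H)).trace =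
      (1 * (H * M ^ t * L * R * (H * M ^ t * L)ᵀ)).trace := by
    rw [← Matrix.mul_assoc, Matrix.trace_mul_comm, Matrix.one_mul]
    simp only [Matrix.transpose_mul, Matrix.mul_assoc]
  rw [← h7, one_mul] at h6
  refine Real.le_sqrt_of_sq_le ?_
  rw [le_div_iff₀ hr]
  linarith

/-- Coercivity: since `A = A_L + L H`, bounds on all `H A_Lˢ L` propagate to `H Aᵗ L`, and these
determine `L` by observability. -/
theorem exists_norm_le_of_mem_sublevel (hobs : IsObservable A H) (hQ : Q.PosSemidef)
    (hR : R.PosDef) (α : ℝ) : ∃ B : ℝ, ∀ L ∈ sublevel A H Q R α, ‖L‖ ≤ B := by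
  obtain ⟨r, hr, hRr⟩ := PosDef.exists_lower_bound hR
  have hb : ∀ t : ℕ, ∃ b : ℝ, ∀ L ∈ sublevel A H Q R α, ∀ s : ℕ,
      ‖H * closedLoop A H L ^ s * A ^ t * L‖ ≤ b := by
    intro t
    induction t with
    | zero =>
      refine ⟨√(α / r), fun L hL s => ?_⟩
      rw [pow_zero, Matrix.mul_one]
      exact norm_output_gain_le hQ hR.posSemidef hr hRr hL s
    | succ t ih =>
      obtain ⟨b, hb⟩ := ih
      refine ⟨b + √(α / r) * b, fun L hL s => ?_⟩
      have hA : A = closedLoop A H L + L * H := by simp [closedLoop]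
      have hsplit : H * closedLoop A H L ^ s * A ^ (t + 1) * L =
          H * closedLoop A H L ^ (s + 1) * A ^ t * L +
            H * closedLoop A H L ^ s * L * (H * closedLoop A H L ^ 0 * A ^ t * L) := by
        have : A ^ (t + 1) = closedLoop A H L * A ^ t + L * H * A ^ t := by
          rw [← Matrix.add_mul, ← hA, pow_succ']
        rw [this, pow_succ]
        simp only [pow_zero, Matrix.mul_one, Matrix.mul_add, Matrix.add_mul, Matrix.mul_assoc]
      rw [hsplit]
      refine (norm_add_le _ _).trans (add_le_add (hb L hL _) ?_)
      refine (Matrix.frobenius_norm_mul _ _).trans ?_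
      exact mul_le_mul (norm_output_gain_le hQ hR.posSemidef hr hRr hL s) (hb L hL 0)
        (norm_nonneg _) (Real.sqrt_nonneg _)
  choose b hb using hb
  obtain ⟨N, hN⟩ := hobs.exists_horizon
  -- The radius `0` selects the gain `L = 0`, whose closed loop is `A` itself.
  obtain ⟨c, hc, hgram⟩ := exists_finGramian_lower_bound hN 0
  have hgram0 := hgram 0 (by simp)
  refine ⟨√((∑ t ∈ Finset.range N, b t ^ 2) / c), fun L hL => ?_⟩
  refine Real.le_sqrt_of_sq_le ?_
  rw [le_div_iff₀ hc]
  have h1 := mul_trace_le_trace_mul hgram0 (posSemidef_mul_transpose_self L)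
  rw [trace_mul_transpose_self] at h1
  have h2 : (finGramian H N (closedLoop A H 0) * (L * Lᵀ)).trace =
      ∑ t ∈ Finset.range N, ‖H * A ^ t * L‖ ^ 2 := by
    rw [finGramian, Finset.sum_mul, Matrix.trace_sum]
    refine Finset.sum_congr rfl fun t _ => ?_
    rw [← trace_mul_transpose_self, Matrix.mul_assoc, Matrix.trace_mul_comm]
    simp only [closedLoop, Matrix.zero_mul, sub_zero, Matrix.transpose_mul, Matrix.mul_assoc]
  have h3 : ∑ t ∈ Finset.range N, ‖H * A ^ t * L‖ ^ 2 ≤ ∑ t ∈ Finset.range N, b t ^ 2 := by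
    refine Finset.sum_le_sum fun t _ => pow_le_pow_left₀ (norm_nonneg _) ?_ 2
    simpa using hb t L hL 0
  linarith

/-- The Gramians `Y(L)` are uniformly positive definite on a sublevel set. -/
theorem exists_obsGramian_lower_bound (hobs : IsObservable A H) (hQ : Q.PosSemidef)
    (hR : R.PosDef) (α : ℝ) : ∃ y > (0 : ℝ), ∀ L ∈ sublevel A H Q R α,
      (obsGramian A H L - y • (1 : Matrix (Fin n) (Fin n) ℝ)).PosSemidef := by
  obtain ⟨B, hB⟩ := exists_norm_le_of_mem_sublevel hobs hQ hR α
  obtain ⟨N, hN⟩ := hobs.exists_horizon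
  obtain ⟨c, hc, hgram⟩ := exists_finGramian_lower_bound hN B
  refine ⟨c, hc, fun L hL => ?_⟩
  have h1 := lyap_sub_sum_posSemidef
    (summable_norm_transpose_pow (summable_norm_closedLoop_pow hL.1))
    (posSemidef_transpose_mul_self H) N
  have h2 : ∑ t ∈ Finset.range N, (closedLoop A H L)ᵀ ^ t * (Hᵀ * H) *
      ((closedLoop A H L)ᵀ ^ t)ᵀ = finGramian H N (closedLoop A H L) := by
    refine Finset.sum_congr rfl fun t _ => ?_
    simp only [Matrix.transpose_mul, Matrix.transpose_pow, Matrix.transpose_transpose,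
      Matrix.mul_assoc]
  rw [h2] at h1
  have h3 := h1.add (hgram L (hB L hL))
  rwa [sub_add_sub_cancel] at h3

/-- The traces of `X(L)` are bounded on a sublevel set: the cost sees `X(L)` through `N` outputs,
hence completely. -/
theorem exists_trace_steadyCov_le (hobs : IsObservable A H) (hQ : Q.PosSemidef)
    (hR : R.PosDef) (α : ℝ) :
    ∃ C : ℝ, ∀ L ∈ sublevel A H Q R α, (steadyCov A H Q R L).trace ≤ C := by
  obtain ⟨B, hB⟩ := exists_norm_le_of_mem_sublevel hobs hQ hR α
  obtain ⟨N, hN⟩ := hobs.exists_horizon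
  obtain ⟨c, hc, hgram⟩ := exists_finGramian_lower_bound hN B
  -- Each of the `N` terms of the Gramian contributes at most `tr (X Hᵀ H) ≤ α`, because
  -- `A_Lᵗ X (A_Lᵗ)ᵀ ≤ X`.
  refine ⟨N * α / c, fun L hL => ?_⟩
  have hM := summable_norm_closedLoop_pow hL.1
  have h1 := mul_trace_le_trace_mul (hgram L (hB L hL))
    (steadyCov_posSemidef hQ hR.posSemidef hL.1)
  have h2 : (finGramian H N (closedLoop A H L) * steadyCov A H Q R L).trace ≤ N * α := by
    rw [finGramian, Finset.sum_mul, Matrix.trace_sum]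
    refine (Finset.sum_le_card_nsmul _ _ α fun t _ => ?_).trans_eq (by simp)
    refine le_trans (le_of_eq ?_) ((trace_mul_le_of_sub_posSemidef
      (lyap_sub_pow_posSemidef hM (posSemidef_noise hQ hR.posSemidef L) t)
      (posSemidef_transpose_mul_self H)).trans (trace_steadyCov_le hR.posSemidef hL))
    have h3 := Matrix.trace_mul_comm (closedLoop A H L ^ t * steadyCov A H Q R L)
      ((closedLoop A H L ^ t)ᵀ * (Hᵀ * H))
    rw [← steadyCov_eq_lyap]
    simp only [Matrix.transpose_mul, Matrix.mul_assoc] at h3 ⊢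
    exact h3.symm
  rw [le_div_iff₀ hc]
  linarith

/-- On a sublevel set the powers of `A_L` are square summable with a common bound, so that
stability is not lost in the limit. -/
theorem exists_sum_norm_sq_closedLoop_pow_le (hobs : IsObservable A H) (hQ : Q.PosDef)
    (hR : R.PosDef) (α : ℝ) : ∃ C : ℝ, ∀ L ∈ sublevel A H Q R α, ∀ T : ℕ,
      ∑ t ∈ Finset.range T, ‖closedLoop A H L ^ t‖ ^ 2 ≤ C := by
  obtain ⟨C, hC⟩ := exists_trace_steadyCov_le hobs hQ.posSemidef hR α
  obtain ⟨q, hq, hQq⟩ := PosDef.exists_lower_bound hQ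
  refine ⟨C / q, fun L hL T => ?_⟩
  have hG := posSemidef_noise hQ.posSemidef hR.posSemidef L
  have h1 := (lyap_sub_sum_posSemidef (summable_norm_closedLoop_pow hL.1) hG T).trace_nonneg
  rw [Matrix.trace_sub, ← steadyCov_eq_lyap, Matrix.trace_sum, sub_nonneg] at h1
  have hGq : (Q + L * R * Lᵀ - q • (1 : Matrix (Fin n) (Fin n) ℝ)).PosSemidef := by
    rw [add_sub_right_comm]
    exact hQq.add (posSemidef_mul_mul_transpose hR.posSemidef L)
  have h2 : ∑ t ∈ Finset.range T, q * ‖closedLoop A H L ^ t‖ ^ 2 ≤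
      ∑ t ∈ Finset.range T,
        (closedLoop A H L ^ t * (Q + L * R * Lᵀ) * (closedLoop A H L ^ t)ᵀ).trace := by
    refine Finset.sum_le_sum fun t _ => ?_
    simpa using mul_norm_sq_le_trace (P := (1 : Matrix (Fin n) (Fin n) ℝ)) (c := 1) zero_le_one
      (by simpa using Matrix.PosSemidef.zero) hGq hG (closedLoop A H L ^ t)
  rw [← Finset.mul_sum] at h2
  rw [le_div_iff₀ hq]
  linarith [hC L hL]

theorem isClosed_sublevel (hobs : IsObservable A H) (hQ : Q.PosDef) (hR : R.PosDef) (α : ℝ) :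
    IsClosed (sublevel A H Q R α) := by
  obtain ⟨C, hC⟩ := exists_sum_norm_sq_closedLoop_pow_le hobs hQ hR α
  refine isClosed_of_closure_subset fun L hL => ?_
  have hcl : IsClosed {L : Matrix (Fin n) (Fin m) ℝ |
      ∀ T : ℕ, ∑ t ∈ Finset.range T, ‖closedLoop A H L ^ t‖ ^ 2 ≤ C} := by
    simp only [Set.ofPred_forall]
    refine isClosed_iInter fun T => isClosed_le ?_ continuous_const
    unfold closedLoop
    fun_prop
  have hLC := closure_minimal (s := sublevel A H Q R α) hC hcl hL
  have hsum : Summable fun t : ℕ => ‖closedLoop A H L ^ t‖ ^ 2 :=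
    summable_of_sum_range_le (fun t => by positivity) hLC
  have hlim : Tendsto (fun t : ℕ => ‖closedLoop A H L ^ t‖) atTop (𝓝 0) := by
    simpa using hsum.tendsto_atTop_zero.sqrt
  obtain ⟨k, hk⟩ := exists_norm_pow_lt hlim
  have hLs : L ∈ stabilizing A H := spectralRadius_lt_one_of_norm_pow_lt hk
  refine ⟨hLs, ?_⟩
  by_contra! hlt
  have hev := (differentiableAt_cost (Q := Q) (R := R) hLs).continuousAt.eventually
    (eventually_gt_nhds hlt)
  obtain ⟨L', h1, h2⟩ := ((mem_closure_iff_frequently.mp hL).and_eventually hev).exists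
  exact absurd h1.2 (not_le.mpr h2)

theorem isCompact_sublevel (hobs : IsObservable A H) (hQ : Q.PosDef) (hR : R.PosDef) (α : ℝ) :
    IsCompact (sublevel A H Q R α) := by
  obtain ⟨B, hB⟩ := exists_norm_le_of_mem_sublevel hobs hQ.posSemidef hR α
  have : ProperSpace (Matrix (Fin n) (Fin m) ℝ) := FiniteDimensional.proper ℝ _
  exact (isCompact_closedBall (0 : Matrix (Fin n) (Fin m) ℝ) B).of_isClosed_subset
    (isClosed_sublevel hobs hQ hR α) fun L hL => by simpa using hB L hL

end Sublevel

/-! ### The minimizer and gradient dominance -/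

section Dominance
variable {n m : ℕ} {A : Matrix (Fin n) (Fin n) ℝ} {H : Matrix (Fin m) (Fin n) ℝ}
  {Q : Matrix (Fin n) (Fin n) ℝ} {R : Matrix (Fin m) (Fin m) ℝ}
  {L Lstar : Matrix (Fin n) (Fin m) ℝ} {α : ℝ}

theorem innovCov_posSemidef (hQ : Q.PosSemidef) (hR : R.PosSemidef)
    (hL : L ∈ stabilizing A H) : (innovCov A H Q R L).PosSemidef :=
  hR.add (posSemidef_mul_mul_transpose (steadyCov_posSemidef hQ hR hL) H)

theorem innovCov_sub_posSemidef (hQ : Q.PosSemidef) (hR : R.PosSemidef) {r : ℝ}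
    (hRr : (R - r • (1 : Matrix (Fin m) (Fin m) ℝ)).PosSemidef) (hL : L ∈ stabilizing A H) :
    (innovCov A H Q R L - r • (1 : Matrix (Fin m) (Fin m) ℝ)).PosSemidef := by
  rw [innovCov, add_sub_right_comm]
  exact hRr.add (posSemidef_mul_mul_transpose (steadyCov_posSemidef hQ hR hL) H)

theorem exists_minimizer (hobs : IsObservable A H) (hQ : Q.PosDef) (hR : R.PosDef)
    (hne : (sublevel A H Q R α).Nonempty) :
    ∃ Lstar ∈ stabilizing A H,
      ∀ L ∈ stabilizing A H, cost A H Q R Lstar ≤ cost A H Q R L := by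
  obtain ⟨Lstar, hLs, hmin⟩ := (isCompact_sublevel hobs hQ hR α).exists_isMinOn hne
    fun L hL => (differentiableAt_cost (Q := Q) (R := R) hL.1).continuousAt.continuousWithinAt
  refine ⟨Lstar, hLs.1, fun L hL => ?_⟩
  by_cases h : cost A H Q R L ≤ α
  · exact hmin ⟨hL, h⟩
  · exact hLs.2.trans (not_le.mp h).le

/-- At a minimizer the gradient `2 Y E` vanishes, hence so does `E`, as `Y` is positive
definite. -/
theorem residual_eq_zero (hobs : IsObservable A H) (hQ : Q.PosDef) (hR : R.PosDef)
    (hLs : Lstar ∈ stabilizing A H)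
    (hmin : ∀ L ∈ stabilizing A H, cost A H Q R Lstar ≤ cost A H Q R L) :
    residual A H Q R Lstar = 0 := by
  have hloc : IsLocalMin (cost A H Q R) Lstar := by
    filter_upwards [(isOpen_stabilizing A H).mem_nhds hLs] with L hL
    exact hmin L hL
  obtain ⟨y, hy, hY⟩ := exists_obsGramian_lower_bound hobs hQ.posSemidef hR (cost A H Q R Lstar)
  have h1 := fderiv_cost_apply hQ.posSemidef hR.posSemidef hLs (residual A H Q R Lstar)
  have hz : fderiv ℝ (cost A H Q R) Lstar = 0 := hloc.fderiv_eq_zero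
  rw [hz, _root_.zero_apply] at h1
  have h2 := mul_trace_le_trace_mul (hY Lstar ⟨hLs, le_rfl⟩)
    (posSemidef_mul_transpose_self (residual A H Q R Lstar))
  rw [trace_mul_transpose_self] at h2
  have h4 : y * ‖residual A H Q R Lstar‖ ^ 2 ≤ 0 := by linarith
  have h5 : ‖residual A H Q R Lstar‖ ^ 2 ≤ 0 := nonpos_of_mul_nonpos_right h4 hy
  exact norm_eq_zero.mp (pow_eq_zero_iff two_ne_zero |>.mp (le_antisymm h5 (sq_nonneg _)))

/-- Where the residual vanishes only the quadratic term of the expansion is left. -/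
theorem quadratic_growth (hQ : Q.PosSemidef) (hR : R.PosSemidef)
    (hLs : Lstar ∈ stabilizing A H) (hres : residual A H Q R Lstar = 0)
    (hL : L ∈ stabilizing A H) {y r : ℝ} (hy : 0 ≤ y)
    (hY : (obsGramian A H L - y • (1 : Matrix (Fin n) (Fin n) ℝ)).PosSemidef)
    (hRr : (R - r • (1 : Matrix (Fin m) (Fin m) ℝ)).PosSemidef) :
    y * r * ‖L - Lstar‖ ^ 2 ≤ cost A H Q R L - cost A H Q R Lstar := by
  rw [cost_sub_cost hQ hR hLs hL, hres, Matrix.zero_mul, Matrix.mul_zero, Matrix.trace_zero,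
    mul_zero, zero_add]
  exact mul_norm_sq_le_trace hy hY (innovCov_sub_posSemidef hQ hR hRr hLs)
    (innovCov_posSemidef hQ hR hLs) _

theorem cost_lt_cost (hobs : IsObservable A H) (hQ : Q.PosDef) (hR : R.PosDef)
    (hLs : Lstar ∈ stabilizing A H) (hres : residual A H Q R Lstar = 0)
    (hL : L ∈ stabilizing A H) (hne : L ≠ Lstar) :
    cost A H Q R Lstar < cost A H Q R L := by
  obtain ⟨y, hy, hY⟩ := exists_obsGramian_lower_bound hobs hQ.posSemidef hR (cost A H Q R L)
  obtain ⟨r, hr, hRr⟩ := PosDef.exists_lower_bound hR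
  have h1 := quadratic_growth hQ.posSemidef hR.posSemidef hLs hres hL hy.le (hY L ⟨hL, le_rfl⟩) hRr
  have h2 : 0 < ‖L - Lstar‖ := norm_pos_iff.mpr (sub_ne_zero.mpr hne)
  have h3 : 0 < y * r * ‖L - Lstar‖ ^ 2 := by positivity
  linarith

theorem two_mul_norm_residual_le (hQ : Q.PosSemidef) (hR : R.PosSemidef)
    (hL : L ∈ stabilizing A H) {y : ℝ}
    (hY : (obsGramian A H L - y • (1 : Matrix (Fin n) (Fin n) ℝ)).PosSemidef) :
    2 * y * ‖residual A H Q R L‖ ≤ ‖frobGradient (cost A H Q R) L‖ := by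
  rcases (norm_nonneg (residual A H Q R L)).eq_or_lt with h0 | hpos
  · rw [← h0, mul_zero]
    exact norm_nonneg _
  have h1 := mul_trace_le_trace_mul hY (posSemidef_mul_transpose_self (residual A H Q R L))
  rw [trace_mul_transpose_self] at h1
  have h2 := (le_abs_self _).trans
    (abs_frobInner_le (frobGradient (cost A H Q R) L) (residual A H Q R L))
  rw [frobInner_frobGradient, fderiv_cost_apply hQ hR hL] at h2
  refine le_of_mul_le_mul_right ?_ hpos
  calc 2 * y * ‖residual A H Q R L‖ * ‖residual A H Q R L‖
      = 2 * (y * ‖residual A H Q R L‖ ^ 2) := by ring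
    _ ≤ _ := by linarith

theorem abs_trace_mul_mul_transpose_le (P : Matrix (Fin n) (Fin n) ℝ)
    (E D : Matrix (Fin n) (Fin m) ℝ) : |(P * (E * Dᵀ)).trace| ≤ ‖P‖ * ‖E‖ * ‖D‖ := by
  have h1 : (P * (E * Dᵀ)).trace = frobInner D (P * E) := by
    rw [← Matrix.mul_assoc, Matrix.trace_mul_comm, frobInner]
  rw [h1]
  refine (abs_frobInner_le _ _).trans ?_
  rw [mul_comm]
  exact mul_le_mul_of_nonneg_right (Matrix.frobenius_norm_mul _ _) (norm_nonneg _)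

/-- The expansion around `L`, evaluated at `L*` with the fixed Gramian `Y(L*)`, bounds the
suboptimality gap by the residual after completing the square. -/
theorem cost_gap_le_residual (hQ : Q.PosSemidef) (hR : R.PosSemidef)
    (hLs : Lstar ∈ stabilizing A H) (hL : L ∈ stabilizing A H) {y r : ℝ} (hy : 0 < y)
    (hr : 0 < r) (hY : (obsGramian A H Lstar - y • (1 : Matrix (Fin n) (Fin n) ℝ)).PosSemidef)
    (hRr : (R - r • (1 : Matrix (Fin m) (Fin m) ℝ)).PosSemidef) :
    y * r * (cost A H Q R L - cost A H Q R Lstar) ≤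
      ‖obsGramian A H Lstar‖ ^ 2 * ‖residual A H Q R L‖ ^ 2 := by
  have h1 := cost_sub_cost hQ hR hL hLs
  have h2 := mul_norm_sq_le_trace hy.le hY (innovCov_sub_posSemidef hQ hR hRr hL)
    (innovCov_posSemidef hQ hR hL) (Lstar - L)
  have h3 := (abs_le.mp (abs_trace_mul_mul_transpose_le (obsGramian A H Lstar)
    (residual A H Q R L) (Lstar - L))).1
  have h4 : cost A H Q R L - cost A H Q R Lstar ≤
      2 * (‖obsGramian A H Lstar‖ * ‖residual A H Q R L‖ * ‖Lstar - L‖)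
        - y * r * ‖Lstar - L‖ ^ 2 := by linarith
  have h5 := mul_le_mul_of_nonneg_left h4 (mul_pos hy hr).le
  linarith [sq_nonneg (‖obsGramian A H Lstar‖ * ‖residual A H Q R L‖ - y * r * ‖Lstar - L‖)]

theorem exists_isGradientDominance (hobs : IsObservable A H) (hQ : Q.PosDef) (hR : R.PosDef)
    (hLs : Lstar ∈ sublevel A H Q R α) (hres : residual A H Q R Lstar = 0) :
    ∃ c₁ c₂ c₃ : ℝ, IsGradientDominance A H Q R α Lstar c₁ c₂ c₃ := by
  obtain ⟨y, hy, hY⟩ := exists_obsGramian_lower_bound hobs hQ.posSemidef hR α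
  obtain ⟨r, hr, hRr⟩ := PosDef.exists_lower_bound hR
  -- `4 y² · y r · gap ≤ 4 y² ‖Y(L*)‖² ‖E‖² ≤ ‖Y(L*)‖² ‖∇J‖²`; half of the resulting multiple of
  -- `‖∇J‖²` pays for the gap, the other half for the distance.
  set b := ‖obsGramian A H Lstar‖ ^ 2 + 1 with hb
  have hb0 : 0 < b := by positivity
  refine ⟨2 * y ^ 2 * (y * r) / b, 2 * y ^ 2 * (y * r) / b * (y * r), y * r, by positivity,
    by positivity, by positivity, fun L hL => ?_⟩
  rw [frobInner_self, frobInner_self]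
  have hgrow := quadratic_growth hQ.posSemidef hR.posSemidef hLs.1 hres hL.1 hy.le (hY L hL) hRr
  refine ⟨?_, hgrow⟩
  set gap := cost A H Q R L - cost A H Q R Lstar with hgap
  have h1 : y * r * gap ≤ b * ‖residual A H Q R L‖ ^ 2 :=
    (cost_gap_le_residual hQ.posSemidef hR.posSemidef hLs.1 hL.1 hy hr (hY Lstar hLs) hRr).trans
      (mul_le_mul_of_nonneg_right (by linarith) (sq_nonneg _))
  have h2 : (2 * y * ‖residual A H Q R L‖) ^ 2 ≤ ‖frobGradient (cost A H Q R) L‖ ^ 2 :=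
    pow_le_pow_left₀ (by positivity)
      (two_mul_norm_residual_le hQ.posSemidef hR.posSemidef hL.1 (hY L hL)) 2
  have h3 : 2 * (2 * y ^ 2 * (y * r) / b) * gap ≤ (2 * y * ‖residual A H Q R L‖) ^ 2 := by
    rw [show 2 * (2 * y ^ 2 * (y * r) / b) * gap = 4 * y ^ 2 * (y * r * gap) / b by ring,
      div_le_iff₀ hb0]
    have := mul_le_mul_of_nonneg_left h1 (show (0 : ℝ) ≤ 4 * y ^ 2 by positivity)
    linarith
  have h4 := mul_le_mul_of_nonneg_left hgrow
    (show (0 : ℝ) ≤ 2 * y ^ 2 * (y * r) / b by positivity)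
  linarith

end Dominance

/-! ### Existence of global flows -/

section Flow
variable {E : Type*} [NormedAddCommGroup E] [NormedSpace ℝ E]

/-- A bounded Lipschitz vector field has forward solutions for all times. -/
theorem exists_forward_solution_of_lipschitz [CompleteSpace E] {v : E → E} {K C : ℝ≥0}
    (hv : LipschitzWith K v) (hC : ∀ x, ‖v x‖ ≤ C) (x₀ : E) :
    ∃ γ : ℝ → E, γ 0 = x₀ ∧
      ∀ s : ℝ, 0 ≤ s → HasDerivWithinAt γ (v (γ s)) (Set.Ici 0) s := by
  have hloc : ∀ N : ℕ, ∃ β : ℝ → E, β 0 = x₀ ∧ ∀ s ∈ Set.Icc (0 : ℝ) (N + 1),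
      HasDerivWithinAt β (v (β s)) (Set.Icc 0 (N + 1)) s := by
    intro N
    have h0 : (0 : ℝ) ∈ Set.Icc (0 : ℝ) (N + 1) := ⟨le_rfl, by positivity⟩
    have hP : IsPicardLindelof (fun _ => v) (⟨0, h0⟩ : Set.Icc (0 : ℝ) (N + 1)) x₀
        (C * (N + 1)) 0 C K :=
      { lipschitzOnWith := fun _ _ => hv.lipschitzOnWith
        continuousOn := fun _ _ => continuousOn_const
        norm_le := fun _ _ x _ => hC x
        mul_max_le := by
          have : (0 : ℝ) ≤ N + 1 := by positivity
          simp [this] }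
    exact hP.exists_eq_forall_mem_Icc_hasDerivWithinAt₀
  choose β hβ0 hβ using hloc
  -- By uniqueness the solutions on the intervals `[0, N + 1]` agree where they overlap.
  have huniq : ∀ N M : ℕ, N ≤ M → ∀ s : ℝ, 0 ≤ s → s ≤ N + 1 → β N s = β M s := by
    intro N M hNM s hs0 hsN
    have hsM : s ≤ M + 1 := hsN.trans (by gcongr)
    have hcont : ∀ J : ℕ, s ≤ J + 1 → ContinuousOn (β J) (Set.Icc 0 s) := fun J hJ t ht =>
      ((hβ J t ⟨ht.1, ht.2.trans hJ⟩).continuousWithinAt).mono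
        (Set.Icc_subset_Icc_right hJ)
    have hder : ∀ J : ℕ, s ≤ J + 1 → ∀ t ∈ Set.Ico (0 : ℝ) s,
        HasDerivWithinAt (β J) (v (β J t)) (Set.Ici t) t := fun J hJ t ht =>
      (hβ J t ⟨ht.1, ht.2.le.trans hJ⟩).mono_of_mem_nhdsWithin <|
        mem_of_superset (Icc_mem_nhdsGE (ht.2.trans_le hJ)) (Set.Icc_subset_Icc_left ht.1)
    exact ODE_solution_unique (v := fun _ => v) (fun _ => hv) (hcont N hsN) (hder N hsN)
      (hcont M hsM) (hder M hsM) ((hβ0 N).trans (hβ0 M).symm) ⟨hs0, le_rfl⟩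
  have hγ : ∀ M : ℕ, ∀ s ∈ Set.Ico (0 : ℝ) (M + 1), β ⌊s⌋₊ s = β M s := by
    intro M s hs
    refine huniq _ _ ?_ s hs.1 (Nat.lt_floor_add_one s).le
    have : ⌊s⌋₊ < M + 1 := (Nat.floor_lt hs.1).mpr (by exact_mod_cast hs.2)
    omega
  refine ⟨fun s => β ⌊s⌋₊ s, by simpa using hβ0 0, fun s hs => ?_⟩
  have hsM : s < (⌊s⌋₊ : ℝ) + 1 := Nat.lt_floor_add_one s
  have hmem : Set.Ico (0 : ℝ) (⌊s⌋₊ + 1) ∈ 𝓝[Set.Ici 0] s := by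
    rw [← Set.Ici_inter_Iio]
    exact inter_mem self_mem_nhdsWithin (mem_nhdsWithin_of_mem_nhds (Iio_mem_nhds hsM))
  have hd := (hβ ⌊s⌋₊ s ⟨hs, hsM.le⟩).mono_of_mem_nhdsWithin
    (mem_of_superset hmem Set.Ico_subset_Icc_self)
  exact hd.congr_of_eventuallyEq (mem_of_superset hmem fun t ht => hγ _ t ht) rfl

/-- A vector field that is `C¹` near a compact set can be damped away from that set, by a factor
`χ` along the solution, so as to have forward solutions for all times. -/
theorem exists_damped_forward_solution [FiniteDimensional ℝ E] {U K : Set E} (hU : IsOpen U)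
    (hK : IsCompact K) (hKU : K ⊆ U) {w : E → E} (hw : ∀ x ∈ U, ContDiffAt ℝ 1 w x) (x₀ : E) :
    ∃ (χ : E → ℝ) (γ : ℝ → E), (∀ x, 0 ≤ χ x) ∧ (∀ x ∈ K, χ x = 1) ∧ γ 0 = x₀ ∧
      ∀ s : ℝ, 0 ≤ s → HasDerivWithinAt γ (χ (γ s) • w (γ s)) (Set.Ici 0) s := by
  have : ProperSpace E := FiniteDimensional.proper ℝ E
  have : CompleteSpace E := FiniteDimensional.complete ℝ E
  obtain ⟨V, hV, hKV, hVU, hVc⟩ := exists_open_between_and_isCompact_closure hK hU hKU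
  obtain ⟨χ, hχd, hχr, hχs, hχ1⟩ :=
    exists_contMDiff_support_eq_eq_one_iff (n := 1) 𝓘(ℝ, E) hV hK.isClosed hKV
  have hχd : ContDiff ℝ 1 χ := hχd.contDiff
  have hsupp : tsupport (fun x => χ x • w x) ⊆ closure V := by
    refine closure_mono fun x hx => ?_
    rw [← hχs]
    exact fun h0 => hx (by simp [h0])
  have hcs : HasCompactSupport fun x => χ x • w x :=
    hVc.of_isClosed_subset (isClosed_tsupport _) hsupp
  have hd : ContDiff ℝ 1 fun x => χ x • w x := by
    rw [contDiff_iff_contDiffAt]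
    intro x
    by_cases hx : x ∈ U
    · exact hχd.contDiffAt.smul (hw x hx)
    · have hx' : x ∉ tsupport fun x => χ x • w x := fun h => hx (hVU (hsupp h))
      exact contDiffAt_const.congr_of_eventuallyEq (notMem_tsupport_iff_eventuallyEq.mp hx')
  obtain ⟨Kl, hKl⟩ := hd.lipschitzWith_of_hasCompactSupport hcs (by norm_num)
  obtain ⟨C, hC⟩ := hd.continuous.bounded_above_of_compact_support hcs
  obtain ⟨γ, hγ0, hγ⟩ := exists_forward_solution_of_lipschitz hKl (C := C.toNNReal)
    (fun x => (hC x).trans (Real.le_coe_toNNReal C)) x₀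
  exact ⟨χ, γ, fun x => (hχr ⟨x, rfl⟩).1, fun x hx => (hχ1 x).mp hx, hγ0, hγ⟩

theorem contDiffAt_fderiv_apply {f : E → ℝ} {x : E} (hf : ContDiffAt ℝ 2 f x) (v : E) :
    ContDiffAt ℝ 1 (fun y => fderiv ℝ f y v) x :=
  (hf.fderiv_right (m := 1) (by norm_num)).clm_apply contDiffAt_const

end Flow

/-! ### The gradient flow of the cost -/

section GradientFlow
variable {n m : ℕ} {A : Matrix (Fin n) (Fin n) ℝ} {H : Matrix (Fin m) (Fin n) ℝ}
  {Q : Matrix (Fin n) (Fin n) ℝ} {R : Matrix (Fin m) (Fin m) ℝ}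
  {Lstar : Matrix (Fin n) (Fin m) ℝ} {α : ℝ}

theorem contDiffAt_frobGradient_cost {L : Matrix (Fin n) (Fin m) ℝ} (hL : L ∈ stabilizing A H) :
    ContDiffAt ℝ 1 (frobGradient (cost A H Q R)) L := by
  have hrep : frobGradient (cost A H Q R) = fun L => ∑ i, ∑ j,
      fderiv ℝ (cost A H Q R) L (Matrix.single i j 1) • Matrix.single i j (1 : ℝ) := by
    funext L
    conv_lhs => rw [Matrix.matrix_eq_sum_single (frobGradient (cost A H Q R) L)]
    simp [Matrix.smul_single, frobGradient]
  rw [hrep]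
  exact ContDiffAt.sum fun i _ => ContDiffAt.sum fun j _ =>
    (contDiffAt_fderiv_apply (contDiffAt_cost (k := 2) hL) _).smul contDiffAt_const

theorem hasDerivWithinAt_cost_comp {γ : ℝ → Matrix (Fin n) (Fin m) ℝ} {c s : ℝ} {T : Set ℝ}
    (hγ : HasDerivWithinAt γ (c • -frobGradient (cost A H Q R) (γ s)) T s)
    (hs : γ s ∈ stabilizing A H) :
    HasDerivWithinAt (fun s => cost A H Q R (γ s))
      (-(c * frobInner (frobGradient (cost A H Q R) (γ s)) (frobGradient (cost A H Q R) (γ s))))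
      T s := by
  have hval : fderiv ℝ (cost A H Q R) (γ s) (c • -frobGradient (cost A H Q R) (γ s)) =
      -(c * frobInner (frobGradient (cost A H Q R) (γ s))
        (frobGradient (cost A H Q R) (γ s))) := by
    rw [smul_neg, map_neg, map_smul, smul_eq_mul, frobInner_frobGradient]
  have h := (differentiableAt_cost (Q := Q) (R := R) hs).hasFDerivAt.comp_hasDerivWithinAt s hγ
  exact h.congr_deriv hval

/-- Descent curves cannot leave a sublevel set: it is closed, and near each of its points the
cost does not increase along the curve. -/
theorem mem_sublevel_of_descent (hobs : IsObservable A H) (hQ : Q.PosDef) (hR : R.PosDef)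
    {γ : ℝ → Matrix (Fin n) (Fin m) ℝ} {c : ℝ → ℝ} (hc : ∀ s, 0 ≤ c s)
    (hγ : ∀ s : ℝ, 0 ≤ s →
      HasDerivWithinAt γ (c s • -frobGradient (cost A H Q R) (γ s)) (Set.Ici 0) s)
    (h0 : γ 0 ∈ sublevel A H Q R α) {s : ℝ} (hs : 0 ≤ s) : γ s ∈ sublevel A H Q R α := by
  have hcont : ContinuousOn γ (Set.Ici 0) := fun t ht => (hγ t ht).continuousWithinAt
  have hsub : Set.Icc 0 s ⊆ γ ⁻¹' sublevel A H Q R α := by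
    refine IsClosed.Icc_subset_of_forall_exists_gt ?_ h0 ?_
    · rw [Set.inter_comm]
      exact (hcont.mono Set.Icc_subset_Ici_self).preimage_isClosed_of_isClosed isClosed_Icc
        (isClosed_sublevel hobs hQ hR α)
    · rintro x ⟨hx, hx0, -⟩ y hy
      have hxy : x < y := hy
      have hnear : ∀ᶠ t in 𝓝[≥] x, γ t ∈ stabilizing A H :=
        ((hcont x hx0).mono (Set.Ici_subset_Ici.mpr hx0)).eventually
          ((isOpen_stabilizing A H).mem_nhds hx.1)
      obtain ⟨u, hu, hus⟩ := mem_nhdsGE_iff_exists_Icc_subset.mp hnear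
      have hxu : x < u := hu
      have hxz : x < min u y := lt_min hxu hxy
      have hst : ∀ t ∈ Set.Icc x (min u y), γ t ∈ stabilizing A H := fun t ht =>
        hus ⟨ht.1, ht.2.trans (min_le_left _ _)⟩
      have hder : ∀ t ∈ Set.Icc x (min u y), HasDerivWithinAt (fun s => cost A H Q R (γ s)) _
          (Set.Ici 0) t := fun t ht => hasDerivWithinAt_cost_comp (hγ t (hx0.trans ht.1)) (hst t ht)
      have hanti : AntitoneOn (fun s => cost A H Q R (γ s)) (Set.Icc x (min u y)) := by
        refine antitoneOn_of_hasDerivWithinAt_nonpos (convex_Icc _ _) (fun t ht =>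
          (hder t ht).continuousWithinAt.mono fun z hz => hx0.trans hz.1)
          (fun t ht => (hder t (interior_subset ht)).mono fun z hz =>
            hx0.trans (interior_subset hz).1) fun t ht => ?_
        rw [frobInner_self, neg_nonpos]
        exact mul_nonneg (hc t) (sq_nonneg _)
      have hz : min u y ∈ Set.Icc x (min u y) := ⟨hxz.le, le_rfl⟩
      exact ⟨min u y, ⟨hst _ hz, (hanti ⟨le_rfl, hxz.le⟩ hz hxz.le).trans hx.2⟩, hxz,
        min_le_right _ _⟩
  exact hsub ⟨hs, le_rfl⟩

theorem exists_isGradientFlow (hobs : IsObservable A H) (hQ : Q.PosDef) (hR : R.PosDef)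
    {L₀ : Matrix (Fin n) (Fin m) ℝ} (hL₀ : L₀ ∈ sublevel A H Q R α) :
    ∃ γ : ℝ → Matrix (Fin n) (Fin m) ℝ, IsGradientFlow (cost A H Q R) L₀ γ := by
  obtain ⟨χ, γ, hχ0, hχ1, hγ0, hγ⟩ := exists_damped_forward_solution (isOpen_stabilizing A H)
    (isCompact_sublevel hobs hQ hR α) (fun L hL => hL.1)
    (w := fun L => -frobGradient (cost A H Q R) L)
    (fun L hL => (contDiffAt_frobGradient_cost hL).neg) L₀
  refine ⟨γ, hγ0, fun s hs => ?_⟩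
  -- The damped solution stays in the sublevel set, where the damping factor is one.
  have hmem := mem_sublevel_of_descent hobs hQ hR (c := fun s => χ (γ s)) (fun s => hχ0 _) hγ
    (by rwa [hγ0]) hs
  have h := hγ s hs
  rwa [hχ1 _ hmem, one_smul] at h

/-- Every gradient flow is a descent curve, so it remains where the cost is differentiable. -/
theorem IsGradientFlow.mem_sublevel (hobs : IsObservable A H) (hQ : Q.PosDef) (hR : R.PosDef)
    {L₀ : Matrix (Fin n) (Fin m) ℝ} (hL₀ : L₀ ∈ sublevel A H Q R α)
    {γ : ℝ → Matrix (Fin n) (Fin m) ℝ} (hγ : IsGradientFlow (cost A H Q R) L₀ γ)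
    {s : ℝ} (hs : 0 ≤ s) : γ s ∈ sublevel A H Q R α :=
  mem_sublevel_of_descent hobs hQ hR (c := fun _ => 1) (fun _ => zero_le_one)
    (fun s hs => by simpa only [one_smul] using hγ.2 s hs) (by rwa [hγ.1]) hs

/-- Under gradient dominance `s ↦ (J(γ s) - J(L*)) exp (c₁ s)` is antitone along the flow. -/
theorem IsGradientFlow.cost_gap_le (hobs : IsObservable A H) (hQ : Q.PosDef) (hR : R.PosDef)
    {c₁ c₂ c₃ : ℝ} (hdom : IsGradientDominance A H Q R α Lstar c₁ c₂ c₃)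
    {L₀ : Matrix (Fin n) (Fin m) ℝ} (hL₀ : L₀ ∈ sublevel A H Q R α)
    {γ : ℝ → Matrix (Fin n) (Fin m) ℝ} (hγ : IsGradientFlow (cost A H Q R) L₀ γ)
    {s : ℝ} (hs : 0 ≤ s) :
    cost A H Q R (γ s) - cost A H Q R Lstar ≤
      (α - cost A H Q R Lstar) * Real.exp (-c₁ * s) := by
  have hmem : ∀ t : ℝ, 0 ≤ t → γ t ∈ sublevel A H Q R α := fun t ht =>
    hγ.mem_sublevel hobs hQ hR hL₀ ht
  have hder : ∀ t ∈ Set.Ici (0 : ℝ), HasDerivWithinAt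
      (fun t => (cost A H Q R (γ t) - cost A H Q R Lstar) * Real.exp (c₁ * t)) _
      (Set.Ici 0) t := fun t ht =>
    ((hasDerivWithinAt_cost_comp (c := 1) (by simpa only [one_smul] using hγ.2 t ht)
      (hmem t ht).1).sub_const _).mul
      (((hasDerivAt_id t).const_mul c₁).exp).hasDerivWithinAt
  have hanti : AntitoneOn
      (fun t => (cost A H Q R (γ t) - cost A H Q R Lstar) * Real.exp (c₁ * t))
      (Set.Ici 0) := by
    refine antitoneOn_of_hasDerivWithinAt_nonpos (convex_Ici _)
      (fun t ht => (hder t ht).continuousWithinAt)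
      (fun t ht => (hder t (interior_subset ht)).mono interior_subset) fun t ht => ?_
    have ht0 : (0 : ℝ) ≤ t := interior_subset ht
    have h1 := (hdom.2.2.2 _ (hmem t ht0)).1
    have h2 : 0 ≤ c₂ * frobInner (γ t - Lstar) (γ t - Lstar) := by
      rw [frobInner_self]
      exact mul_nonneg hdom.2.1.le (sq_nonneg _)
    simp only [id_eq, mul_one, one_mul]
    have h3 := mul_nonneg (sub_nonneg.mpr (h1.trans' (le_add_of_nonneg_right h2)))
      (Real.exp_pos (c₁ * t)).le
    linarith
  have h1 := hanti (Set.mem_Ici.mpr le_rfl) (Set.mem_Ici.mpr hs) hs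
  simp only [mul_zero, Real.exp_zero, mul_one] at h1
  have h2 := h1.trans (sub_le_sub_right (hmem 0 le_rfl).2 _)
  rwa [neg_mul, Real.exp_neg, ← div_eq_mul_inv, le_div_iff₀ (Real.exp_pos _)]

end GradientFlow
end
end KalmanGain

theorem mainTheorem5 {n m : ℕ}
    (A : Matrix (Fin n) (Fin n) ℝ) (H : Matrix (Fin m) (Fin n) ℝ)
    (Q : Matrix (Fin n) (Fin n) ℝ) (R : Matrix (Fin m) (Fin m) ℝ)
    (hobs : KalmanGain.IsObservable A H) (hQ : Q.PosDef) (hR : R.PosDef)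
    (α : ℝ) (hα : 0 < α) (hne : (KalmanGain.sublevel A H Q R α).Nonempty) :
    -- the cost has a true gradient on the domain, so that the flow is meaningful
    (∀ L ∈ KalmanGain.stabilizing A H, DifferentiableAt ℝ (KalmanGain.cost A H Q R) L) ∧
    -- the gradient flow from any point of the sublevel set exists for all times
    (∀ L₀ ∈ KalmanGain.sublevel A H Q R α,
      ∃ γ : ℝ → Matrix (Fin n) (Fin m) ℝ,
        KalmanGain.IsGradientFlow (KalmanGain.cost A H Q R) L₀ γ) ∧
    -- the cost has a unique minimizer
    ∃ Lstar ∈ KalmanGain.stabilizing A H,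
      (∀ L ∈ KalmanGain.stabilizing A H, L ≠ Lstar →
        KalmanGain.cost A H Q R Lstar < KalmanGain.cost A H Q R L) ∧
      -- gradient dominance constants of the sublevel set exist, and any of them give the rates
      (∃ c₁ c₂ c₃ : ℝ, KalmanGain.IsGradientDominance A H Q R α Lstar c₁ c₂ c₃) ∧
      ∀ c₁ c₂ c₃ : ℝ, KalmanGain.IsGradientDominance A H Q R α Lstar c₁ c₂ c₃ →
        ∀ L₀ ∈ KalmanGain.sublevel A H Q R α, ∀ γ : ℝ → Matrix (Fin n) (Fin m) ℝ,
          KalmanGain.IsGradientFlow (KalmanGain.cost A H Q R) L₀ γ →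
          ∀ s : ℝ, 0 ≤ s →
            γ s ∈ KalmanGain.sublevel A H Q R α ∧
            KalmanGain.cost A H Q R (γ s) - KalmanGain.cost A H Q R Lstar
              ≤ (α - KalmanGain.cost A H Q R Lstar) * Real.exp (-c₁ * s) ∧
            KalmanGain.frobInner (γ s - Lstar) (γ s - Lstar)
              ≤ (α - KalmanGain.cost A H Q R Lstar) / c₃ * Real.exp (-c₁ * s) := by
  obtain ⟨Lstar, hLs, hmin⟩ := KalmanGain.exists_minimizer hobs hQ hR hne
  have hres := KalmanGain.residual_eq_zero hobs hQ hR hLs hmin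
  have hLsα : Lstar ∈ KalmanGain.sublevel A H Q R α :=
    ⟨hLs, (hmin _ hne.some_mem.1).trans hne.some_mem.2⟩
  refine ⟨fun L hL => KalmanGain.differentiableAt_cost hL,
    fun L₀ hL₀ => KalmanGain.exists_isGradientFlow hobs hQ hR hL₀, Lstar, hLs,
    fun L hL hne => KalmanGain.cost_lt_cost hobs hQ hR hLs hres hL hne,
    KalmanGain.exists_isGradientDominance hobs hQ hR hLsα hres, ?_⟩
  intro c₁ c₂ c₃ hdom L₀ hL₀ γ hγ s hs
  have hmem := hγ.mem_sublevel hobs hQ hR hL₀ hs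
  have hgap := hγ.cost_gap_le hobs hQ hR hdom hL₀ hs
  refine ⟨hmem, hgap, ?_⟩
  rw [div_mul_eq_mul_div, le_div_iff₀' hdom.2.2.1]
  exact (hdom.2.2.2 _ hmem).2.trans hgap
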